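/- Let $G$ be a finite, compact, connected metric graph, i.e. finitely many intervals $I_j=[0,L_j]$, $L_j>0$, $j=1,\dots,r$ (the edges), whose endpoints are glued according to an equivalence relation with classes $v_1,\dots,v_s$ (the vertices; loops and multiple edges are allowed). The degree of a vertex is the number of endpoints in its class, $\partial G$ is the set of vertices of degree one, and $\operatorname{cyc}(G)=1+r-s$. Let $q_j\in L^1(I_j)$ be real-valued, $\mathcal L f=(-f_j''+q_jf_j)_j$ for $f=(f_j)_j$, and let $AC^2(G)$ be the set of $f=(f_j)_j$ with $f_j,f_j'$ absolutely continuous on $I_j$ for all $j$. Call $f$ continuous on $G$ if each $f_j$ is continuous and endpoints glued to the same vertex $v$ carry the same value, denoted $f(v)$. Let $$\partial_\nu f(v)=\sum_{L_j\in v} f_j'(L_j)-\sum_{0_j\in v} f_j'(0),$$ the sums being over all edges whose endpoint $L_j$, respectively $0$, is glued to $v$. For $\alpha\in\mathbb R^s$ let $A_\alpha$ be the operator in $L^2(G)=\bigoplus_j L^2(I_j)$ with $A_\alpha f=\mathcal L f$, whose domain consists of all $f\in L^2(G)\cap AC^2(G)$ with $\mathcal Lf\in L^2(G)$ that are continuous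 on $G$ and satisfy $\partial_\nu f(v_i)-\alpha_if(v_i)=0$ for $i=1,\dots,s$. Let $B\subset\partial G$ be nonempty. For $\mu\in\mathbb C\setminus\sigma(A_\alpha)$ and $w\in B$ let $f^{(w)}\in AC^2(G)$ be the unique function that is continuous on $G$ with $\mathcal Lf^{(w)}=\mu f^{(w)}$, $\partial_\nu f^{(w)}(w)-\alpha_{w}f^{(w)}(w)=1$ and $\partial_\nu f^{(w)}(v)-\alpha_{v}f^{(w)}(v)=0$ for every vertex $v\neq w$ (where $\alpha_v=\alpha_i$ if $v=v_i$). The Titchmarsh–Weyl function is the matrix function $M_{B,\alpha}(\mu)=\big(f^{(w)}(v)\big)_{v,w\in B}$, $\mu\in\mathbb C\setminus\sigma(A_\alpha)$. Then for every $\lambda\in\mathbb R$ the space $\ker(A_\alpha-\lambda)$ is finite-dimensional, $M_{B,\alpha}$ is analytic in a punctured neighbourhood of $\lambda$ (contained in $\mathbb C\setminus\sigma(A_\alpha)$), so that its residue $\operatorname{Res}_\lambda M_{B,\alpha}$ at $\lambda$ is defined (it is $0$ if the singularity is removable), and the following holds. (i) If $\lambda$ is a pole of $M_{B,\alpha}$,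 then $\lambda$ is an eigenvalue of $A_\alpha$. (ii) If $\lambda$ is an eigenvalue of $A_\alpha$ with $\dim\ker(A_\alpha-\lambda)>2\operatorname{cyc}(G)+|\partial G|-|B|-1$, then $\lambda$ is a pole of $M_{B,\alpha}$. (iii) If $\operatorname{cyc}(G)=0$ (i.e. $G$ is a tree) and $B=\partial G$, then $\dim\ker(A_\alpha-\lambda)=\operatorname{rank}\operatorname{Res}_\lambda M_{B,\alpha}$. Otherwise $$\operatorname{rank}\operatorname{Res}_\lambda M_{B,\alpha}\le\dim\ker(A_\alpha-\lambda)\le\operatorname{rank}\operatorname{Res}_\lambda M_{B,\alpha}+2\operatorname{cyc}(G)+|\partial G|-|B|-1.$$ -/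

import Mathlib

open MeasureTheory Set Filter Topology

noncomputable section

/-- A finite compact metric graph with edge set `E` and vertex set `V` (finiteness of `E` and `V`
is asked for where it is used): the edge `e` is the interval `[0, length e]`, its endpoint `0` is
glued to the vertex `init e` and its endpoint `length e` to the vertex `term e`. Vertices are
classes of endpoints, so each vertex is attached to at least one edge. Loops and multiple edges
are allowed. -/
structure MetricGraph (V E : Type*) where
  init : E → V
  term : E → V
  length : E → ℝ
  length_pos : ∀ e, 0 < length e
  exists_edge : ∀ v, ∃ e, init e = v ∨ term e = v

namespace MetricGraph

variable {V E : Type*} (G : MetricGraph V E)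

/-- The interval `[0, length e]`. -/
abbrev edge (e : E) : Set ℝ := Icc 0 (G.length e)

/-- The vertex of an endpoint; `(e, false)` is the endpoint `0` of the edge `e` and `(e, true)`
is its endpoint `length e`. -/
def endVertex (p : E × Bool) : V := bif p.2 then G.term p.1 else G.init p.1

/-- The coordinate of an endpoint in the interval of its edge. -/
def endCoord (p : E × Bool) : ℝ := bif p.2 then G.length p.1 else 0

theorem exists_endVertex_eq (v : V) : ∃ p, G.endVertex p = v := by
  obtain ⟨e, h | h⟩ := G.exists_edge v
  · exact ⟨(e, false), h⟩
  · exact ⟨(e, true), h⟩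

/-- The degree of a vertex: the number of endpoints that are glued to it (a loop counts twice). -/
def degree (v : V) : ℕ := {p | G.endVertex p = v}.ncard

open Classical in
/-- The boundary: the set of vertices of degree one. -/
def boundary [Fintype V] : Finset V := Finset.univ.filter fun v => G.degree v = 1

/-- Any two vertices are joined by a path of edges. -/
def IsConnected : Prop :=
  ∀ v w, Relation.EqvGen (fun a b => ∃ e, G.init e = a ∧ G.term e = b) v w

/-- The cyclomatic number (of a connected graph). -/
def cyc (_G : MetricGraph V E) [Fintype V] [Fintype E] : ℤ := 1 + Fintype.card E - Fintype.card V

/-! ### Functions on the graph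

A function on `G` is given by functions `u e : ℝ → ℂ`, of which only the restrictions to
the intervals `[0, length e]` matter. -/

/-- The derivative along the edge `e` (one-sided at the two endpoints). -/
def D (e : E) (f : ℝ → ℂ) : ℝ → ℂ := derivWithin f (G.edge e)

/-- `AC²(G)`: on each edge the function and its derivative are absolutely continuous. -/
def IsAC2 (u : E → ℝ → ℂ) : Prop :=
  ∀ e, AbsolutelyContinuousOnInterval (u e) 0 (G.length e) ∧
    DifferentiableOn ℝ (u e) (G.edge e) ∧
    AbsolutelyContinuousOnInterval (G.D e (u e)) 0 (G.length e)

/-- The function is continuous on each edge and endpoints glued to the same vertex carry the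
same value. -/
def IsContinuous (u : E → ℝ → ℂ) : Prop :=
  (∀ e, ContinuousOn (u e) (G.edge e)) ∧
    ∀ p p', G.endVertex p = G.endVertex p' → u p.1 (G.endCoord p) = u p'.1 (G.endCoord p')

/-- The value at a vertex, read off at an arbitrary endpoint that is glued to the vertex. -/
def vertexValue (u : E → ℝ → ℂ) (v : V) : ℂ :=
  u (G.exists_endVertex_eq v).choose.1 (G.endCoord (G.exists_endVertex_eq v).choose)

theorem vertexValue_endVertex {u : E → ℝ → ℂ} (hu : G.IsContinuous u) (p : E × Bool) :
    G.vertexValue u (G.endVertex p) = u p.1 (G.endCoord p) :=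
  hu.2 _ _ (G.exists_endVertex_eq (G.endVertex p)).choose_spec

open Classical in
/-- The sum of the derivatives at the vertex `v` in the directions pointing into `v`, over all
endpoints glued to `v`. -/
def normalDeriv [Fintype E] (u : E → ℝ → ℂ) (v : V) : ℂ :=
  (∑ e, if G.term e = v then G.D e (u e) (G.length e) else 0) -
    ∑ e, if G.init e = v then G.D e (u e) 0 else 0

/-- The Schrödinger differential expression `-u'' + q u`. -/
def schrodinger (q : E → ℝ → ℝ) (u : E → ℝ → ℂ) (e : E) (x : ℝ) : ℂ :=
  -G.D e (G.D e (u e)) x + (q e x : ℂ) * u e x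

/-- The quantity `∂_ν u (v) - α_v u (v)`. -/
def deltaDefect [Fintype E] (α : V → ℝ) (u : E → ℝ → ℂ) (v : V) : ℂ :=
  G.normalDeriv u v - (α v : ℂ) * G.vertexValue u v

/-- The Hilbert space `L²(G)`, the orthogonal sum of the spaces `L²(0, length e)`. -/
abbrev L2 [Fintype E] : Type _ :=
  PiLp 2 fun e : E => Lp ℂ 2 (volume.restrict (G.edge e))

/-! ### Linearity of the differential expression and of the vertex conditions -/

variable {G}

theorem uniqueDiffOn_edge (e : E) : UniqueDiffOn ℝ (G.edge e) :=
  uniqueDiffOn_Icc (G.length_pos e)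

theorem D_add {e : E} {f g : ℝ → ℂ} {x : ℝ} (hf : DifferentiableWithinAt ℝ f (G.edge e) x)
    (hg : DifferentiableWithinAt ℝ g (G.edge e) x) :
    G.D e (f + g) x = G.D e f x + G.D e g x :=
  derivWithin_add hf hg

theorem D_smul {e : E} (c : ℂ) (f : ℝ → ℂ) : G.D e (c • f) = c • G.D e f := by
  funext x
  exact derivWithin_const_smul_field c f

theorem D_congr {e : E} {f g : ℝ → ℂ} (h : EqOn f g (G.edge e)) :
    EqOn (G.D e f) (G.D e g) (G.edge e) :=
  fun _ hx => derivWithin_congr h (h hx)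

theorem IsAC2.D_add_eqOn {u w : E → ℝ → ℂ} (hu : G.IsAC2 u) (hw : G.IsAC2 w) (e : E) :
    EqOn (G.D e (u e + w e)) (G.D e (u e) + G.D e (w e)) (G.edge e) :=
  fun x hx => D_add ((hu e).2.1 x hx) ((hw e).2.1 x hx)

theorem ac_congr {f g : ℝ → ℂ} {a : ℝ} (ha : 0 ≤ a) (h : EqOn f g (Icc 0 a))
    (hf : AbsolutelyContinuousOnInterval f 0 a) : AbsolutelyContinuousOnInterval g 0 a := by
  rw [absolutelyContinuousOnInterval_iff] at hf ⊢
  intro ε hε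
  obtain ⟨δ, hδ, H⟩ := hf ε hε
  refine ⟨δ, hδ, fun I hI hs => ?_⟩
  have := H I hI hs
  rw [Finset.sum_congr rfl fun i hi => ?_] at this
  · exact this
  · have h2 := hI.1 i hi
    rw [uIcc_of_le ha] at h2
    rw [h h2.1, h h2.2]

theorem IsAC2.add {u w : E → ℝ → ℂ} (hu : G.IsAC2 u) (hw : G.IsAC2 w) : G.IsAC2 (u + w) :=
  fun e => ⟨(hu e).1.add (hw e).1, (hu e).2.1.add (hw e).2.1,
    ac_congr (G.length_pos e).le (hu.D_add_eqOn hw e).symm ((hu e).2.2.add (hw e).2.2)⟩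

theorem IsAC2.smul (c : ℂ) {u : E → ℝ → ℂ} (hu : G.IsAC2 u) : G.IsAC2 (c • u) := by
  refine fun e => ⟨(hu e).1.const_smul c, (hu e).2.1.const_smul c, ?_⟩
  rw [Pi.smul_apply, D_smul]
  exact (hu e).2.2.const_smul c

theorem IsContinuous.add {u w : E → ℝ → ℂ} (hu : G.IsContinuous u) (hw : G.IsContinuous w) :
    G.IsContinuous (u + w) :=
  ⟨fun e => (hu.1 e).add (hw.1 e), fun p p' h => by simp [hu.2 p p' h, hw.2 p p' h]⟩

theorem IsContinuous.smul (c : ℂ) {u : E → ℝ → ℂ} (hu : G.IsContinuous u) :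
    G.IsContinuous (c • u) :=
  ⟨fun e => (hu.1 e).const_smul c, fun p p' h => by simp [hu.2 p p' h]⟩

theorem schrodinger_add (q : E → ℝ → ℝ) {u w : E → ℝ → ℂ} (hu : G.IsAC2 u) (hw : G.IsAC2 w)
    (e : E) : G.schrodinger q (u + w) e =ᵐ[volume.restrict (G.edge e)]
      G.schrodinger q u e + G.schrodinger q w e := by
  have key : ∀ {u : E → ℝ → ℂ}, G.IsAC2 u → ∀ᵐ x ∂volume.restrict (G.edge e),
      DifferentiableWithinAt ℝ (G.D e (u e)) (G.edge e) x := by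
    intro u hu
    have := (hu e).2.2.boundedVariationOn
    rw [uIcc_of_le (G.length_pos e).le] at this
    exact this.locallyBoundedVariationOn.ae_differentiableWithinAt measurableSet_Icc
  filter_upwards [key hu, key hw, ae_restrict_mem measurableSet_Icc] with x h1 h2 hx
  have h3 : G.D e (G.D e (u e + w e)) x = G.D e (G.D e (u e) + G.D e (w e)) x :=
    D_congr (hu.D_add_eqOn hw e) hx
  simp only [schrodinger, Pi.add_apply]
  rw [h3, D_add h1 h2]
  ring

theorem schrodinger_smul (q : E → ℝ → ℝ) (c : ℂ) (u : E → ℝ → ℂ) (e : E) :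
    G.schrodinger q (c • u) e = c • G.schrodinger q u e := by
  funext x
  simp only [schrodinger, Pi.smul_apply, D_smul, smul_eq_mul]
  ring

theorem deltaDefect_add [Fintype E] (α : V → ℝ) {u w : E → ℝ → ℂ} (hu : G.IsAC2 u)
    (hw : G.IsAC2 w) (v : V) :
    G.deltaDefect α (u + w) v = G.deltaDefect α u v + G.deltaDefect α w v := by
  have h0 : ∀ e, G.D e (u e + w e) 0 = G.D e (u e) 0 + G.D e (w e) 0 := fun e =>
    hu.D_add_eqOn hw e (left_mem_Icc.2 (G.length_pos e).le)
  have h1 : ∀ e, G.D e (u e + w e) (G.length e) =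
      G.D e (u e) (G.length e) + G.D e (w e) (G.length e) := fun e =>
    hu.D_add_eqOn hw e (right_mem_Icc.2 (G.length_pos e).le)
  have h2 : ∀ (P : Prop) [Decidable P] (a b : ℂ),
      (if P then a + b else 0) = (if P then a else 0) + (if P then b else 0) := by
    intro P _ a b; split_ifs <;> simp
  simp only [deltaDefect, normalDeriv, vertexValue, Pi.add_apply, h0, h1, h2,
    Finset.sum_add_distrib]
  ring

theorem deltaDefect_smul [Fintype E] (α : V → ℝ) (c : ℂ) (u : E → ℝ → ℂ) (v : V) :
    G.deltaDefect α (c • u) v = c * G.deltaDefect α u v := by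
  have h2 : ∀ (P : Prop) [Decidable P] (a : ℂ),
      (if P then c * a else 0) = c * (if P then a else 0) := by
    intro P _ a; split_ifs <;> simp
  simp only [deltaDefect, normalDeriv, vertexValue, Pi.smul_apply, D_smul, smul_eq_mul, h2,
    ← Finset.mul_sum]
  ring

variable (G)

/-! ### The operator with `δ`-type vertex conditions -/

variable [Fintype E]

/-- The graph of `A_α`: the pairs `(f, g)` of elements of `L²(G)` such that `f` is (the class of)
a function in `AC²(G)` that is continuous on `G`, satisfies `∂_ν f (v) - α_v f (v) = 0` at each
vertex `v`, and has `-f'' + q f = g`. -/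
def operatorGraph (q : E → ℝ → ℝ) (α : V → ℝ) : Submodule ℂ (G.L2 × G.L2) where
  carrier := {p | ∃ u : E → ℝ → ℂ, G.IsAC2 u ∧
    (∀ e, p.1 e =ᵐ[volume.restrict (G.edge e)] u e) ∧
    (∀ e, p.2 e =ᵐ[volume.restrict (G.edge e)] G.schrodinger q u e) ∧
    G.IsContinuous u ∧ ∀ v, G.deltaDefect α u v = 0}
  zero_mem' := by
    have hD : ∀ e, G.D e (0 : ℝ → ℂ) = 0 := fun e => by
      simpa using D_smul (G := G) (e := e) 0 0
    have hac : ∀ a : ℝ, AbsolutelyContinuousOnInterval (0 : ℝ → ℂ) 0 a := fun a => by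
      rw [absolutelyContinuousOnInterval_iff]
      exact fun ε hε => ⟨1, one_pos, fun _ _ _ => by simpa using hε⟩
    refine ⟨0, fun e => ⟨hac _, differentiableOn_const 0, ?_⟩, fun e => ?_, fun e => ?_,
      ⟨fun e => continuousOn_const, fun _ _ _ => rfl⟩, fun v => ?_⟩
    · rw [Pi.zero_apply, hD]; exact hac _
    · exact Lp.coeFn_zero _ _ _
    · have : G.schrodinger q 0 e = 0 := by
        funext x; simp [schrodinger, hD]
      rw [this]; exact Lp.coeFn_zero _ _ _
    · simpa using G.deltaDefect_smul α 0 0 v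
  add_mem' := by
    rintro a b ⟨u, h1, h2, h3, h4, h5⟩ ⟨w, k1, k2, k3, k4, k5⟩
    refine ⟨u + w, h1.add k1, fun e => ?_, fun e => ?_, h4.add k4, fun v => ?_⟩
    · exact (Lp.coeFn_add (a.1 e) (b.1 e)).trans ((h2 e).add (k2 e))
    · exact (Lp.coeFn_add (a.2 e) (b.2 e)).trans
        (((h3 e).add (k3 e)).trans (schrodinger_add q h1 k1 e).symm)
    · rw [deltaDefect_add α h1 k1, h5, k5, add_zero]
  smul_mem' := by
    rintro c a ⟨u, h1, h2, h3, h4, h5⟩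
    refine ⟨c • u, h1.smul c, fun e => ?_, fun e => ?_, h4.smul c, fun v => ?_⟩
    · exact (Lp.coeFn_smul c (a.1 e)).trans ((h2 e).const_smul c)
    · rw [schrodinger_smul]
      exact (Lp.coeFn_smul c (a.2 e)).trans ((h3 e).const_smul c)
    · rw [deltaDefect_smul, h5, mul_zero]

/-- The graph of `A_α` is single-valued. -/
theorem operatorGraph_snd_eq_zero (q : E → ℝ → ℝ) (α : V → ℝ) (p : G.L2 × G.L2)
    (hp : p ∈ G.operatorGraph q α) (h0 : p.1 = 0) : p.2 = 0 := by
  obtain ⟨u, h1, h2, h3, h4, -⟩ := hp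
  ext e : 1
  have hu : EqOn (u e) 0 (G.edge e) := by
    refine Measure.eqOn_Icc_of_ae_eq volume (G.length_pos e).ne ?_ (h4.1 e) continuousOn_const
    refine (h2 e).symm.trans ?_
    rw [h0]
    exact Lp.coeFn_zero _ _ _
  have hD : G.D e (0 : ℝ → ℂ) = 0 := by simpa using D_smul (G := G) (e := e) 0 0
  have hu1 : EqOn (G.D e (u e)) 0 (G.edge e) := by simpa [hD] using D_congr hu
  have hu2 : EqOn (G.D e (G.D e (u e))) 0 (G.edge e) := by simpa [hD] using D_congr hu1
  refine Lp.ext ((h3 e).trans (EventuallyEq.trans ?_ (Lp.coeFn_zero _ _ _).symm))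
  filter_upwards [ae_restrict_mem measurableSet_Icc] with x hx
  simp [schrodinger, hu hx, hu2 hx]

/-- The Schrödinger operator `A_α` in `L²(G)`. -/
def schrodingerOperator (q : E → ℝ → ℝ) (α : V → ℝ) : G.L2 →ₗ.[ℂ] G.L2 :=
  (G.operatorGraph q α).toLinearPMap

theorem graph_schrodingerOperator (q : E → ℝ → ℝ) (α : V → ℝ) :
    (G.schrodingerOperator q α).graph = G.operatorGraph q α :=
  Submodule.toLinearPMap_graph_eq _ (G.operatorGraph_snd_eq_zero q α)

/-! ### The Titchmarsh--Weyl function -/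

/-- `u` is in `AC²(G)` (hence in `L²(G)`), is continuous on `G`, solves `-u'' + q u = μ u` and
satisfies `∂_ν u (v) - α_v u (v) = h v` at each vertex `v`. -/
def IsSolution (q : E → ℝ → ℝ) (α : V → ℝ) (μ : ℂ) (h : V → ℂ) (u : E → ℝ → ℂ) : Prop :=
  G.IsAC2 u ∧ (∀ e, ∀ᵐ x ∂volume.restrict (G.edge e), G.schrodinger q u e x = μ * u e x) ∧
    G.IsContinuous u ∧ ∀ v, G.deltaDefect α u v = h v

open Classical in
/-- The Titchmarsh--Weyl function `μ ↦ M_{B,α}(μ)`: the entry `(k, l)` is the value at the vertex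
`k` of the solution `u` with `∂_ν u (v) - α_v u (v) = δ_{v,l}`. It is meaningful for `μ` in the
resolvent set of `A_α`, where there is one and only one such solution. -/
def titchmarshWeyl (q : E → ℝ → ℝ) (α : V → ℝ) (B : Finset V) (μ : ℂ) : Matrix B B ℂ :=
  fun k l => if H : ∃ u, G.IsSolution q α μ (fun v => if v = l then 1 else 0) u then
    G.vertexValue H.choose k else 0

end MetricGraph

/-! ### Spectral notions for unbounded operators -/

namespace LinearPMap

variable {H : Type*} [NormedAddCommGroup H] [NormedSpace ℂ H]

/-- `ker (T - μ)` for a partially defined operator `T`: the `x` in the domain with `T x = μ x`. -/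
def eigenspace (T : H →ₗ.[ℂ] H) (μ : ℂ) : Submodule ℂ H :=
  T.graph.comap (LinearMap.prod LinearMap.id (μ • LinearMap.id))

/-- `μ` is an eigenvalue of `T`. -/
def IsEigenvalue (T : H →ₗ.[ℂ] H) (μ : ℂ) : Prop := T.eigenspace μ ≠ ⊥

/-- The resolvent set, the complement of the spectrum: the `μ` such that `T - μ` maps the domain
of `T` bijectively onto `H`, with a bounded inverse `R`. -/
def resolventSet (T : H →ₗ.[ℂ] H) : Set ℂ :=
  {μ | ∃ R : H →L[ℂ] H, (∀ y, ∃ hy : R y ∈ T.domain, T ⟨R y, hy⟩ - μ • R y = y) ∧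
    ∀ x : T.domain, R (T x - μ • (x : H)) = x}

end LinearPMap

/-! ### Poles and residues of matrix functions -/

namespace MatrixFunction

variable {n : Type*}

/-- The matrix function `M` with domain `U` is defined and analytic in a punctured neighbourhood
of `c`. -/
def IsIsolated (U : Set ℂ) (M : ℂ → Matrix n n ℂ) (c : ℂ) : Prop :=
  ∀ᶠ z in 𝓝[≠] c, z ∈ U ∧ ∀ k l, AnalyticAt ℂ (fun w => M w k l) z

/-- `c` is a pole (of some order `m ≥ 1`) of the matrix function `M` with domain `U`. -/
def IsPole (U : Set ℂ) (M : ℂ → Matrix n n ℂ) (c : ℂ) : Prop :=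
  IsIsolated U M c ∧ ∃ m : ℕ, 1 ≤ m ∧ ∃ L : Matrix n n ℂ, L ≠ 0 ∧
    Tendsto (fun z => (z - c) ^ m • M z) (𝓝[≠] c) (𝓝 L)

/-- `R` is the residue at `c` of the matrix function `M` with domain `U`: `M` is analytic in a
punctured neighbourhood of `c` and `R = (2πi)⁻¹ ∮ M(z) dz` over all small circles around `c`. -/
def HasResidue (U : Set ℂ) (M : ℂ → Matrix n n ℂ) (c : ℂ) (R : Matrix n n ℂ) : Prop :=
  IsIsolated U M c ∧ ∀ᶠ r in 𝓝[>] (0 : ℝ), ∀ k l,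
    (2 * Real.pi * Complex.I)⁻¹ * ∮ z in C(c, r), M z k l = R k l

end MatrixFunction

end

/-!
The proof rests on three facts about the solutions of `-u'' + q u = μ u` on the edges.

*The singularity at `lam` is at most a simple pole.* A solution on the edges is determined by its
Cauchy data at the initial endpoints, a vector in `E × Bool → ℂ`, and depends on `μ` as an entire
function (`differentiable_solutionOp`: on each edge it is given by the inverse of `1 - K`, where `K`
is a quasi-nilpotent Volterra operator that is affine in `μ`). The conditions at all vertices amount
to as many linear equations as there are Cauchy data, so they are given by a square matrix that is
entire in `μ`, the `characteristicMatrix`; its kernel is the eigenspace (`eigenspaceEquiv`). By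
Lagrange's identity its determinant has no non-real zeros. Hence the inverse is meromorphic, and
the determinant is nonzero near `lam`, except possibly at `lam` itself. Where it does not vanish at
`μ` and at the conjugate of `μ`, the resolvent exists (`mem_resolventSet`; boundedness comes from
the closed graph theorem and the symmetry of the operator), and `M` can be computed from the inverse
matrix. If `f` solves the problem with data `k` in the vertex conditions and spectral parameter `z`,
and if `w` is a solution of the homogeneous problem at `lam`, then Lagrange's identity reads
`(z - lam) ∫ f w = -∑ v, k v * w v`. Multiplied by a power of `z - lam` it shows that the leading
Laurent coefficient of `f` at a pole of order at least two is orthogonal to its own conjugate, hence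
zero (`exists_simple_pole`).

*The rank of the residue is the rank of the restriction to `B` of the functions in the eigenspace*
(`exists_residue`). For a simple pole the same identity says that the residue `ρ l` of the solution
with data `δ_l` is in the eigenspace and `∫ (ρ l) w = -w l`. So `ρ` is a negative adjoint of the
restriction map `T` to `B`, and `Res M = T ∘ ρ` has the rank of `T`
(`Matrix.rank_eq_finrank_range_of_adjoint`). The dimension of the eigenspace is therefore
`rank Res M + dim ker T`.

*The kernel of `T` is small.* For this the vertices are ordered such that each vertex outside `B`
has an earlier neighbour; then a function in `ker T` is zero if certain derivatives vanish, one for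
each edge, and the vertex condition makes one of these superfluous at each vertex that has a later
neighbour (`IsSolution.eqOn_zero_of_endDeriv`). Hence `dim ker T` is at most `|E| - |V|` plus the
number of the vertices without later neighbour, here called sinks. The order is obtained from a
spanning tree: go up from `B` to the root, then down into the remaining branches
(`SpanningTree.exists_order`). Apart from the root, a sink then is a vertex of degree one outside
`B`, or it is attached to one of the `cyc G` edges outside the tree, and no two sinks share such an
edge. If the root is taken in `∂G ∖ B`, or on an edge outside the tree, then the root is no
exception, and there are at most `cyc G + |∂G| - |B|` sinks. This is possible unless `cyc G = 0` and
`B = ∂G`, in which case only the root can be a sink and `ker T = 0`.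
-/

noncomputable section

/-! ### Absolutely continuous complex-valued functions -/

section AbsolutelyContinuous

variable {L : ℝ} {f g h : ℝ → ℂ}

theorem AbsolutelyContinuousOnInterval.of_dist_le {X Y : Type*} [PseudoMetricSpace X]
    [PseudoMetricSpace Y] {f : ℝ → X} {g : ℝ → Y} {a b : ℝ}
    (hf : AbsolutelyContinuousOnInterval f a b) (H : ∀ x y, dist (g x) (g y) ≤ dist (f x) (f y)) :
    AbsolutelyContinuousOnInterval g a b := by
  rw [absolutelyContinuousOnInterval_iff] at hf ⊢
  intro ε hε
  obtain ⟨δ, hδ, H'⟩ := hf ε hε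
  exact ⟨δ, hδ, fun I hI hs => (Finset.sum_le_sum fun i _ => H _ _).trans_lt (H' I hI hs)⟩

theorem AbsolutelyContinuousOnInterval.re {a b : ℝ} (hf : AbsolutelyContinuousOnInterval f a b) :
    AbsolutelyContinuousOnInterval (fun x => (f x).re) a b :=
  hf.of_dist_le fun x y => by
    rw [dist_eq_norm, dist_eq_norm, ← Complex.sub_re]
    exact Complex.abs_re_le_norm _

theorem AbsolutelyContinuousOnInterval.im {a b : ℝ} (hf : AbsolutelyContinuousOnInterval f a b) :
    AbsolutelyContinuousOnInterval (fun x => (f x).im) a b :=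
  hf.of_dist_le fun x y => by
    rw [dist_eq_norm, dist_eq_norm, ← Complex.sub_im]
    exact Complex.abs_im_le_norm _

theorem AbsolutelyContinuousOnInterval.conj {a b : ℝ}
    (hf : AbsolutelyContinuousOnInterval f a b) :
    AbsolutelyContinuousOnInterval (fun x => (starRingEnd ℂ) (f x)) a b :=
  hf.of_dist_le fun x y => by
    rw [dist_eq_norm, dist_eq_norm, ← map_sub, RCLike.norm_conj]

theorem AbsolutelyContinuousOnInterval.ofReal {a b : ℝ} {f : ℝ → ℝ}
    (hf : AbsolutelyContinuousOnInterval f a b) :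
    AbsolutelyContinuousOnInterval (fun x => (f x : ℂ)) a b :=
  hf.of_dist_le fun x y => by
    rw [dist_eq_norm, dist_eq_norm, ← Complex.ofReal_sub, Complex.norm_real]

theorem absolutelyContinuousOnInterval_const {X : Type*} [PseudoMetricSpace X] (c : X) (a b : ℝ) :
    AbsolutelyContinuousOnInterval (fun _ : ℝ => c) a b := by
  rw [absolutelyContinuousOnInterval_iff]
  exact fun ε hε => ⟨1, one_pos, fun _ _ _ => by simpa using hε⟩

theorem MeasureTheory.IntegrableOn.intervalIntegrable_zero {F : Type*} [NormedAddCommGroup F]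
    {h : ℝ → F} (hh : IntegrableOn h (Icc 0 L)) {x : ℝ} (hx : x ∈ Icc 0 L) :
    IntervalIntegrable h volume 0 x := by
  rw [intervalIntegrable_iff, uIoc_of_le hx.1]
  exact hh.mono_set (Ioc_subset_Icc_self.trans (Icc_subset_Icc_right hx.2))

theorem absolutelyContinuous_primitive (hL : 0 ≤ L) (hh : IntegrableOn h (Icc 0 L)) :
    AbsolutelyContinuousOnInterval (fun x => ∫ t in 0..x, h t) 0 L := by
  have hi := hh.intervalIntegrable_zero (right_mem_Icc.2 hL)
  have hre : IntegrableOn (fun t => (h t).re) (Icc 0 L) := hh.re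
  have him : IntegrableOn (fun t => (h t).im) (Icc 0 L) := hh.im
  have h1 := ((hre.intervalIntegrable_zero
    (right_mem_Icc.2 hL)).absolutelyContinuousOnInterval_intervalIntegral (c := 0) (by simp)).ofReal
  have h2 := ((him.intervalIntegrable_zero
    (right_mem_Icc.2 hL)).absolutelyContinuousOnInterval_intervalIntegral (c := 0) (by simp)).ofReal
  refine MetricGraph.ac_congr hL (fun x hx => ?_) (h1.add (h2.const_smul Complex.I))
  have hx' := hh.intervalIntegrable_zero hx
  apply Complex.ext
  · have := Complex.reCLM.intervalIntegral_comp_comm hx'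
    simpa using this
  · have := Complex.imCLM.intervalIntegral_comp_comm hx'
    simpa using this

/-- Lebesgue's differentiation theorem for a primitive, with the one-sided derivative. -/
theorem derivWithin_ae_eq_of_eqOn_primitive (hL : 0 < L) (hh : IntegrableOn h (Icc 0 L)) {c : ℂ}
    (hf : ∀ x ∈ Icc 0 L, f x = c + ∫ t in 0..x, h t) :
    derivWithin f (Icc 0 L) =ᵐ[volume.restrict (Icc 0 L)] h := by
  have hi := hh.intervalIntegrable_zero (right_mem_Icc.2 hL.le)
  rw [EventuallyEq, ae_restrict_iff' measurableSet_Icc]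
  filter_upwards [hi.ae_hasDerivAt_integral] with x hx hxI
  have h1 := (hx (by rwa [uIcc_of_le hL.le]) 0 (by simp)).hasDerivWithinAt (s := Icc 0 L)
  have h2 : HasDerivWithinAt f (h x) (Icc 0 L) x :=
    (h1.const_add c).congr (fun y hy => hf y hy) (hf x hxI)
  exact h2.derivWithin (uniqueDiffOn_Icc hL x hxI)

theorem hasDerivWithinAt_of_eqOn_primitive (hh : ContinuousOn h (Icc 0 L)) {c : ℂ}
    (hf : ∀ x ∈ Icc 0 L, f x = c + ∫ t in 0..x, h t) {x : ℝ} (hx : x ∈ Icc 0 L) :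
    HasDerivWithinAt f (h x) (Icc 0 L) x := by
  have hi : IntegrableOn h (Icc 0 L) := hh.integrableOn_Icc
  have : Fact (x ∈ Icc 0 L) := ⟨hx⟩
  have h1 : HasDerivWithinAt (fun y => ∫ t in 0..y, h t) (h x) (Icc 0 L) x :=
    intervalIntegral.integral_hasDerivWithinAt_right (hi.intervalIntegrable_zero hx)
      (hh.stronglyMeasurableAtFilter_nhdsWithin measurableSet_Icc x) (hh x hx)
  exact (h1.const_add c).congr (fun y hy => hf y hy) (hf x hx)

/-- The fundamental theorem of calculus for a complex-valued absolutely continuous function. -/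
theorem AbsolutelyContinuousOnInterval.integral_derivWithin (hL : 0 < L)
    (hf : AbsolutelyContinuousOnInterval f 0 L) :
    IntegrableOn (derivWithin f (Icc 0 L)) (Icc 0 L) ∧
      ∀ x ∈ Icc 0 L, f x = f 0 + ∫ t in 0..x, derivWithin f (Icc 0 L) t := by
  have hd : derivWithin f (Icc 0 L) =ᵐ[volume.restrict (Icc 0 L)] fun x =>
      ((deriv (fun x => (f x).re) x : ℝ) : ℂ) +
        ((deriv (fun x => (f x).im) x : ℝ) : ℂ) * Complex.I := by
    -- Mathlib's results on absolutely continuous functions are for real-valued ones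
    rw [EventuallyEq, ae_restrict_iff' measurableSet_Icc]
    filter_upwards [hf.re.ae_differentiableAt, hf.im.ae_differentiableAt] with x h1 h2 hx
    rw [uIcc_of_le hL.le] at h1 h2
    have h3 := ((h1 hx).hasDerivAt.ofReal_comp.add
      ((h2 hx).hasDerivAt.ofReal_comp.mul_const Complex.I)).hasDerivWithinAt (s := Icc 0 L)
    refine HasDerivWithinAt.derivWithin (h3.congr_of_mem (fun y _ => ?_) hx)
      (uniqueDiffOn_Icc hL x hx)
    simp [Complex.re_add_im]
  have key : ∀ {g : ℝ → ℝ}, AbsolutelyContinuousOnInterval g 0 L →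
      IntegrableOn (fun x => ((deriv g x : ℝ) : ℂ)) (Icc 0 L) := fun {g} hg => by
    have := hg.intervalIntegrable_deriv
    rw [intervalIntegrable_iff_integrableOn_Icc_of_le hL.le] at this
    exact this.ofReal
  have hre := key hf.re
  have him := (key hf.im).mul_const Complex.I
  have hint := (hre.add him).congr hd.symm
  refine ⟨hint, fun x hx => ?_⟩
  have hsub : uIcc 0 x ⊆ uIcc 0 L := by
    rw [uIcc_of_le hx.1, uIcc_of_le hL.le]; exact Icc_subset_Icc_right hx.2
  have e1 := (hf.re.mono hsub).integral_deriv_eq_sub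
  have e2 := (hf.im.mono hsub).integral_deriv_eq_sub
  have : ∫ t in 0..x, derivWithin f (Icc 0 L) t = ∫ t in 0..x,
      (((deriv (fun x => (f x).re) t : ℝ) : ℂ) +
        ((deriv (fun x => (f x).im) t : ℝ) : ℂ) * Complex.I) := by
    refine intervalIntegral.integral_congr_ae ?_
    rw [EventuallyEq, ae_restrict_iff' measurableSet_Icc] at hd
    filter_upwards [hd] with t ht htx
    rw [uIoc_of_le hx.1] at htx
    exact ht ⟨htx.1.le, htx.2.trans hx.2⟩
  rw [this, intervalIntegral.integral_add (IntegrableOn.intervalIntegrable_zero hre hx)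
    (IntegrableOn.intervalIntegrable_zero him hx), intervalIntegral.integral_mul_const,
    intervalIntegral.integral_ofReal, intervalIntegral.integral_ofReal, e1, e2]
  apply Complex.ext <;> simp

/-- A function with prescribed Cauchy data at `0` and prescribed integrable second derivative. -/
theorem ac2_of_eqOn_integral (hL : 0 < L) (hh : IntegrableOn h (Icc 0 L)) {c d : ℂ}
    (hf : ∀ x ∈ Icc 0 L, f x = c + ∫ s in 0..x, (d + ∫ t in 0..s, h t)) :
    AbsolutelyContinuousOnInterval f 0 L ∧ DifferentiableOn ℝ f (Icc 0 L) ∧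
      AbsolutelyContinuousOnInterval (derivWithin f (Icc 0 L)) 0 L ∧
      (∀ x ∈ Icc 0 L, derivWithin f (Icc 0 L) x = d + ∫ t in 0..x, h t) ∧
      derivWithin (derivWithin f (Icc 0 L)) (Icc 0 L) =ᵐ[volume.restrict (Icc 0 L)] h := by
  have hac := (absolutelyContinuousOnInterval_const d 0 L).add
    (absolutelyContinuous_primitive hL.le hh)
  have hcont := hac.continuousOn
  rw [uIcc_of_le hL.le] at hcont
  have hder : ∀ x ∈ Icc 0 L, HasDerivWithinAt f (d + ∫ t in 0..x, h t) (Icc 0 L) x := fun x hx =>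
    hasDerivWithinAt_of_eqOn_primitive (h := fun s => d + ∫ t in 0..s, h t) hcont hf hx
  have hD : ∀ x ∈ Icc 0 L, derivWithin f (Icc 0 L) x = d + ∫ t in 0..x, h t := fun x hx =>
    (hder x hx).derivWithin (uniqueDiffOn_Icc hL x hx)
  refine ⟨?_, fun x hx => (hder x hx).differentiableWithinAt, ?_, hD,
    derivWithin_ae_eq_of_eqOn_primitive hL hh hD⟩
  · exact MetricGraph.ac_congr hL.le (fun x hx => (hf x hx).symm)
      ((absolutelyContinuousOnInterval_const c 0 L).add
        (absolutelyContinuous_primitive hL.le hcont.integrableOn_Icc))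
  · exact MetricGraph.ac_congr hL.le (fun x hx => (hD x hx).symm) hac

theorem eq_integral_of_ac2 (hL : 0 < L) (hf : AbsolutelyContinuousOnInterval f 0 L)
    (hf' : AbsolutelyContinuousOnInterval (derivWithin f (Icc 0 L)) 0 L) :
    IntegrableOn (derivWithin (derivWithin f (Icc 0 L)) (Icc 0 L)) (Icc 0 L) ∧
      ∀ x ∈ Icc 0 L, f x = f 0 + ∫ s in 0..x, (derivWithin f (Icc 0 L) 0 +
        ∫ t in 0..s, derivWithin (derivWithin f (Icc 0 L)) (Icc 0 L) t) := by
  refine ⟨(hf'.integral_derivWithin hL).1, fun x hx => ?_⟩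
  rw [(hf.integral_derivWithin hL).2 x hx]
  congr 1
  refine intervalIntegral.integral_congr fun s hs => ?_
  rw [uIcc_of_le hx.1] at hs
  exact (hf'.integral_derivWithin hL).2 s ⟨hs.1, hs.2.trans hx.2⟩

end AbsolutelyContinuous

/-! ### The initial value problem on an interval -/

section Volterra

variable {L : ℝ}

/-- The primitive that vanishes at `0`, as a continuous function on `[0, L]`. -/
def primitiveMap (h : ℝ → ℂ) (hh : IntegrableOn h (Icc 0 L)) : C(Icc (0 : ℝ) L, ℂ) where
  toFun x := ∫ t in 0..(x : ℝ), h t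
  continuous_toFun := by
    have h1 : ContinuousOn (fun x : ℝ => ∫ t in 0..x, h t) (Icc 0 L) := by
      rcases le_or_gt 0 L with hL | hL
      · have := intervalIntegral.continuousOn_primitive_interval (μ := volume) (a := 0) (b := L)
          (f := h) (by rwa [uIcc_of_le hL])
        rwa [uIcc_of_le hL] at this
      · rw [Icc_eq_empty hL.not_ge]; exact continuousOn_empty _
    exact continuousOn_iff_continuous_domRestrict.1 h1

theorem primitiveMap_apply {h : ℝ → ℂ} (hh : IntegrableOn h (Icc 0 L)) (x : Icc (0 : ℝ) L) :
    primitiveMap h hh x = ∫ t in 0..(x : ℝ), h t := rfl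

/-- The identity as a complex-valued continuous function on `[0, L]`. -/
def coordMap (L : ℝ) : C(Icc (0 : ℝ) L, ℂ) where
  toFun x := ((x : ℝ) : ℂ)
  continuous_toFun := by fun_prop

theorem integrableOn_mul_IccExtend {p : ℝ → ℂ} (hL : 0 ≤ L) (hp : IntegrableOn p (Icc 0 L))
    (u : C(Icc (0 : ℝ) L, ℂ)) : IntegrableOn (fun t => p t * IccExtend hL u t) (Icc 0 L) :=
  hp.mul_continuousOn (u.continuous.Icc_extend').continuousOn isCompact_Icc

theorem norm_integral_mul_le {p : ℝ → ℂ} (hp : IntegrableOn p (Icc 0 L)) {v : ℝ → ℂ}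
    {b : ℝ → ℝ} (hb : ContinuousOn b (Icc 0 L)) (hv : ∀ t ∈ Icc 0 L, ‖v t‖ ≤ b t) {x : ℝ}
    (hx : x ∈ Icc 0 L) : ‖∫ t in 0..x, p t * v t‖ ≤ ∫ t in 0..x, ‖p t‖ * b t := by
  have h2 : IntegrableOn (fun t => ‖p t‖ * b t) (Icc 0 L) :=
    IntegrableOn.mul_continuousOn hp.norm hb isCompact_Icc
  refine intervalIntegral.norm_integral_le_of_norm_le hx.1 (ae_of_all _ fun t ht => ?_)
    (h2.intervalIntegrable_zero hx)
  rw [norm_mul]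
  exact mul_le_mul_of_nonneg_left (hv t ⟨ht.1.le, ht.2.trans hx.2⟩) (norm_nonneg _)

/-- The Volterra operator `u ↦ ∫₀ˣ p u` on `C([0, L])`, for an integrable weight `p`. -/
def volterra (hL : 0 ≤ L) (p : ℝ → ℂ) (hp : IntegrableOn p (Icc 0 L)) :
    C(Icc (0 : ℝ) L, ℂ) →L[ℂ] C(Icc (0 : ℝ) L, ℂ) :=
  LinearMap.mkContinuous
    { toFun := fun u => primitiveMap _ (integrableOn_mul_IccExtend hL hp u)
      map_add' := fun u v => by
        ext x
        rw [ContinuousMap.add_apply, primitiveMap_apply, primitiveMap_apply, primitiveMap_apply,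
          ← intervalIntegral.integral_add
          ((integrableOn_mul_IccExtend hL hp u).intervalIntegrable_zero x.2)
          ((integrableOn_mul_IccExtend hL hp v).intervalIntegrable_zero x.2)]
        exact intervalIntegral.integral_congr fun t _ => mul_add _ _ _
      map_smul' := fun c u => by
        ext x
        rw [ContinuousMap.smul_apply, primitiveMap_apply, primitiveMap_apply, smul_eq_mul,
          RingHom.id_apply, ← intervalIntegral.integral_const_mul]
        exact intervalIntegral.integral_congr fun t _ => mul_left_comm _ _ _ }
    (∫ t in 0..L, ‖p t‖) fun u => by
      have h0 : 0 ≤ ∫ t in 0..L, ‖p t‖ :=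
        intervalIntegral.integral_nonneg hL fun t _ => norm_nonneg _
      rw [ContinuousMap.norm_le _ (by positivity)]
      intro x
      refine (norm_integral_mul_le hp (b := fun _ => ‖u‖) continuousOn_const
        (fun t _ => u.norm_coe_le_norm _) x.2).trans ?_
      rw [intervalIntegral.integral_mul_const]
      refine mul_le_mul_of_nonneg_right ?_ (norm_nonneg _)
      exact intervalIntegral.integral_mono_interval le_rfl x.2.1 x.2.2
        (ae_of_all _ fun t => norm_nonneg _)
        (IntegrableOn.intervalIntegrable_zero hp.norm ⟨hL, le_rfl⟩)

theorem volterra_apply (hL : 0 ≤ L) {p : ℝ → ℂ} (hp : IntegrableOn p (Icc 0 L))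
    (u : C(Icc (0 : ℝ) L, ℂ)) (x : Icc (0 : ℝ) L) :
    volterra hL p hp u x = ∫ t in 0..(x : ℝ), p t * IccExtend hL u t := rfl

theorem integrableOn_one : IntegrableOn (fun _ : ℝ => (1 : ℂ)) (Icc 0 L) :=
  continuousOn_const.integrableOn_Icc

theorem integrableOn_ofReal {q : ℝ → ℝ} (hq : IntegrableOn q (Icc 0 L)) :
    IntegrableOn (fun t => (q t : ℂ)) (Icc 0 L) :=
  hq.ofReal

theorem integrableOn_potential {q : ℝ → ℝ} (hq : IntegrableOn q (Icc 0 L)) (μ : ℂ) :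
    IntegrableOn (fun t => (q t : ℂ) - μ) (Icc 0 L) :=
  Integrable.sub (integrableOn_ofReal hq) (continuousOn_const (c := μ)).integrableOn_Icc

/-- `u ↦ ∫₀ˣ ∫₀ˢ p u`. -/
def volterra₂ (hL : 0 ≤ L) (p : ℝ → ℂ) (hp : IntegrableOn p (Icc 0 L)) :
    C(Icc (0 : ℝ) L, ℂ) →L[ℂ] C(Icc (0 : ℝ) L, ℂ) :=
  (volterra hL (fun _ => 1) integrableOn_one).comp (volterra hL p hp)

theorem integral_mul_primitive_pow {a : ℝ → ℝ} (ha : IntegrableOn a (Icc 0 L))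
    (n : ℕ) {x : ℝ} (hx : x ∈ Icc 0 L) :
    ∫ t in 0..x, a t * (∫ s in 0..t, a s) ^ n = (∫ s in 0..x, a s) ^ (n + 1) / (n + 1) := by
  have hi := ha.intervalIntegrable_zero hx
  have hac := hi.absolutelyContinuousOnInterval_intervalIntegral (c := 0) (by simp)
  have hpow : ∀ m : ℕ, AbsolutelyContinuousOnInterval (fun t => (∫ s in 0..t, a s) ^ m) 0 x := by
    intro m
    induction m with
    | zero => simpa using absolutelyContinuousOnInterval_const (1 : ℝ) 0 x
    | succ m ih => simpa only [pow_succ] using ih.fun_mul hac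
  have h1 := (hpow (n + 1)).integral_deriv_eq_sub
  have h2 : ∫ t in 0..x, deriv (fun t => (∫ s in 0..t, a s) ^ (n + 1)) t =
      ∫ t in 0..x, ((n : ℝ) + 1) * (a t * (∫ s in 0..t, a s) ^ n) := by
    refine intervalIntegral.integral_congr_ae ?_
    filter_upwards [hi.ae_hasDerivAt_integral] with t ht htx
    rw [uIoc_of_le hx.1] at htx
    have := (ht (by rw [uIcc_of_le hx.1]; exact Ioc_subset_Icc_self htx) 0
      (by simp)).fun_pow (n + 1)
    rw [this.deriv]
    push_cast
    ring
  rw [h2, intervalIntegral.integral_const_mul] at h1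
  simp only [intervalIntegral.integral_same, ne_eq, Nat.add_eq_zero_iff, one_ne_zero, and_false,
    not_false_eq_true, zero_pow, sub_zero] at h1
  rw [← h1]
  field_simp

/-- The factor `(∫ ‖p‖) ^ n` is needed for the induction only; the factor `1 / n!` comes from
`integral_mul_primitive_pow` and makes the powers of the operator tend to zero. -/
theorem norm_volterra₂_pow_apply_le (hL : 0 ≤ L) {p : ℝ → ℂ} (hp : IntegrableOn p (Icc 0 L))
    (n : ℕ) (u : C(Icc (0 : ℝ) L, ℂ)) (x : Icc (0 : ℝ) L) :
    ‖(volterra₂ hL p hp ^ n) u x‖ ≤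
      ‖u‖ * (L ^ n / n.factorial) * (∫ t in 0..(x : ℝ), ‖p t‖) ^ n := by
  induction n generalizing x with
  | zero => simpa using u.norm_coe_le_norm x
  | succ n ih =>
    set Q : ℝ → ℝ := fun x => ∫ t in 0..x, ‖p t‖ with hQ
    have hQc : ContinuousOn Q (Icc 0 L) := by
      have := intervalIntegral.continuousOn_primitive_interval (μ := volume) (a := 0) (b := L)
        (f := fun t => ‖p t‖) (by rw [uIcc_of_le hL]; exact hp.norm)
      rwa [uIcc_of_le hL] at this
    have hQm : ∀ {s t : ℝ}, 0 ≤ s → s ≤ t → t ∈ Icc 0 L → Q s ≤ Q t := fun hs hst ht =>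
      intervalIntegral.integral_mono_interval le_rfl hs hst
        (ae_of_all _ fun t => norm_nonneg _) (IntegrableOn.intervalIntegrable_zero hp.norm ht)
    have hQ0 : ∀ t ∈ Icc 0 L, 0 ≤ Q t := fun t ht =>
      intervalIntegral.integral_nonneg ht.1 fun t _ => norm_nonneg _
    set C : ℝ := ‖u‖ * (L ^ n / n.factorial) with hC
    have hC0 : 0 ≤ C := by positivity
    set w := (volterra₂ hL p hp ^ n) u with hw
    have h1 : ∀ s : Icc (0 : ℝ) L, ‖volterra hL p hp w s‖ ≤ C * (Q s ^ (n + 1) / (n + 1)) := by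
      intro s
      rw [volterra_apply]
      refine (norm_integral_mul_le hp (b := fun t => C * Q t ^ n)
        (continuousOn_const.mul (hQc.pow n)) (fun t ht => ?_) s.2).trans ?_
      · rw [IccExtend_of_mem hL _ ht]; exact ih ⟨t, ht⟩
      · rw [← integral_mul_primitive_pow hp.norm n s.2, ← intervalIntegral.integral_const_mul]
        refine le_of_eq (intervalIntegral.integral_congr fun t _ => ?_)
        ring
    have h2 : (volterra₂ hL p hp ^ (n + 1)) u x =
        ∫ t in 0..(x : ℝ), 1 * IccExtend hL (volterra hL p hp w) t := by
      rw [pow_succ']; rfl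
    rw [h2]
    have h3 := intervalIntegral.norm_integral_le_of_norm_le_const (a := 0) (b := (x : ℝ))
      (C := C * (Q x ^ (n + 1) / (n + 1)))
      (f := fun t => 1 * IccExtend hL (volterra hL p hp w) t) fun t ht => by
        rw [uIoc_of_le x.2.1] at ht
        have ht' : t ∈ Icc 0 L := ⟨ht.1.le, ht.2.trans x.2.2⟩
        rw [one_mul, IccExtend_of_mem hL _ ht']
        refine (h1 ⟨t, ht'⟩).trans ?_
        have := hQ0 t ht'
        have := hQm ht'.1 ht.2 x.2
        simp only
        gcongr
    refine h3.trans ?_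
    have hx := hQ0 x x.2
    rw [sub_zero, abs_of_nonneg x.2.1]
    calc C * (Q x ^ (n + 1) / (n + 1)) * x ≤ C * (Q x ^ (n + 1) / (n + 1)) * L :=
          mul_le_mul_of_nonneg_left x.2.2 (by positivity)
      _ = _ := by
          rw [hC, Nat.factorial_succ]; push_cast; field_simp; ring

theorem isUnit_one_sub_of_isUnit_one_sub_pow {R : Type*} [Ring R] (a : R) (n : ℕ)
    (h : IsUnit (1 - a ^ n)) : IsUnit (1 - a) := by
  rw [← mul_neg_geom_sum] at h
  have hcomm : Commute (1 - a) (∑ i ∈ Finset.range n, a ^ i) :=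
    Commute.sum_right _ _ _ fun i _ => (Commute.one_left _).sub_left ((Commute.refl a).pow_right i)
  exact (hcomm.isUnit_mul_iff.1 h).1

/-- The Volterra equation `u = r + ∫₀ˣ ∫₀ˢ p u` is uniquely solvable in `C([0, L])`. -/
theorem isUnit_one_sub_volterra₂ (hL : 0 ≤ L) {p : ℝ → ℂ} (hp : IntegrableOn p (Icc 0 L)) :
    IsUnit (1 - volterra₂ hL p hp) := by
  set K := volterra₂ hL p hp with hK
  set Q : ℝ := ∫ t in 0..L, ‖p t‖ with hQ
  have hQ0 : 0 ≤ Q := intervalIntegral.integral_nonneg hL fun t _ => norm_nonneg _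
  have hn : ∀ n : ℕ, ‖K ^ n‖ ≤ (L * Q) ^ n / n.factorial := fun n => by
    refine ContinuousLinearMap.opNorm_le_bound _ (by positivity) fun u => ?_
    rw [ContinuousMap.norm_le _ (by positivity)]
    intro x
    refine (norm_volterra₂_pow_apply_le hL hp n u x).trans ?_
    have h1 : ∫ t in 0..(x : ℝ), ‖p t‖ ≤ Q :=
      intervalIntegral.integral_mono_interval le_rfl x.2.1 x.2.2
        (ae_of_all _ fun t => norm_nonneg _)
        (IntegrableOn.intervalIntegrable_zero hp.norm ⟨hL, le_rfl⟩)
    have h0 : 0 ≤ ∫ t in 0..(x : ℝ), ‖p t‖ :=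
      intervalIntegral.integral_nonneg x.2.1 fun t _ => norm_nonneg _
    calc _ ≤ ‖u‖ * (L ^ n / n.factorial) * Q ^ n := by gcongr
      _ = _ := by rw [mul_pow]; ring
  obtain ⟨n, hn1⟩ := ((FloorSemiring.tendsto_pow_div_factorial_atTop (L * Q)).eventually
    (gt_mem_nhds one_pos)).exists
  have hu := isUnit_one_sub_of_norm_lt_one (x := K ^ n) ((hn n).trans_lt hn1)
  exact isUnit_one_sub_of_isUnit_one_sub_pow K n hu

end Volterra

section InitialValueProblem

variable {L : ℝ}

/-- `f` and `f'` are absolutely continuous on `[0, L]` and `-f'' + q f = μ f + g` almost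
everywhere. -/
def IsEdgeSolution (L : ℝ) (q : ℝ → ℝ) (μ : ℂ) (g f : ℝ → ℂ) : Prop :=
  (AbsolutelyContinuousOnInterval f 0 L ∧ DifferentiableOn ℝ f (Icc 0 L) ∧
    AbsolutelyContinuousOnInterval (derivWithin f (Icc 0 L)) 0 L) ∧
    ∀ᵐ x ∂volume.restrict (Icc 0 L),
      -derivWithin (derivWithin f (Icc 0 L)) (Icc 0 L) x + (q x : ℂ) * f x = μ * f x + g x

/-- The inverse of `1 - K`, where `K u = ∫₀ˣ ∫₀ˢ (q - μ) u`. -/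
def solutionOp (hL : 0 ≤ L) {q : ℝ → ℝ} (hq : IntegrableOn q (Icc 0 L)) (μ : ℂ) :
    C(Icc (0 : ℝ) L, ℂ) →L[ℂ] C(Icc (0 : ℝ) L, ℂ) :=
  Ring.inverse (1 - volterra₂ hL (fun t => (q t : ℂ) - μ) (integrableOn_potential hq μ))

theorem eq_solutionOp_iff (hL : 0 ≤ L) {q : ℝ → ℝ} (hq : IntegrableOn q (Icc 0 L)) (μ : ℂ)
    (u r : C(Icc (0 : ℝ) L, ℂ)) : u = solutionOp hL hq μ r ↔
      u - volterra₂ hL (fun t => (q t : ℂ) - μ) (integrableOn_potential hq μ) u = r := by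
  have hu := isUnit_one_sub_volterra₂ hL (integrableOn_potential hq μ)
  constructor
  · rintro rfl
    exact congrArg (fun T => T r) (Ring.mul_inverse_cancel _ hu)
  · intro h
    rw [← h]
    exact (congrArg (fun T => T u) (Ring.inverse_mul_cancel _ hu)).symm

theorem volterra_sub (hL : 0 ≤ L) {q : ℝ → ℝ} (hq : IntegrableOn q (Icc 0 L)) (μ : ℂ) :
    volterra hL (fun t => (q t : ℂ) - μ) (integrableOn_potential hq μ) =
      volterra hL (fun t => (q t : ℂ)) (integrableOn_ofReal hq) -
        μ • volterra hL (fun _ => 1) integrableOn_one := by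
  ext u x
  simp only [sub_apply, smul_apply,
    ContinuousMap.sub_apply, ContinuousMap.smul_apply, volterra_apply, smul_eq_mul]
  rw [← intervalIntegral.integral_const_mul, ← intervalIntegral.integral_sub
    ((integrableOn_mul_IccExtend hL (integrableOn_ofReal hq) u).intervalIntegrable_zero x.2)
    (((integrableOn_mul_IccExtend hL integrableOn_one u).intervalIntegrable_zero x.2).const_mul μ)]
  exact intervalIntegral.integral_congr fun t _ => by ring

theorem differentiable_sub_smul {F : Type*} [NormedAddCommGroup F] [NormedSpace ℂ F] (a b : F) :
    Differentiable ℂ fun μ : ℂ => a - μ • b := by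
  fun_prop

theorem differentiable_volterra (hL : 0 ≤ L) {q : ℝ → ℝ} (hq : IntegrableOn q (Icc 0 L)) :
    Differentiable ℂ fun μ : ℂ =>
      volterra hL (fun t => (q t : ℂ) - μ) (integrableOn_potential hq μ) := by
  have h := differentiable_sub_smul (volterra hL (fun t => (q t : ℂ)) (integrableOn_ofReal hq))
    (volterra hL (fun _ => 1) integrableOn_one)
  have he : (fun μ : ℂ => volterra hL (fun t => (q t : ℂ) - μ) (integrableOn_potential hq μ)) =
      fun μ : ℂ => volterra hL (fun t => (q t : ℂ)) (integrableOn_ofReal hq) -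
        μ • volterra hL (fun _ => 1) integrableOn_one := funext (volterra_sub hL hq)
  rw [he]
  exact h

theorem differentiable_inverse_affine {R : Type*} [NormedRing R] [NormedAlgebra ℂ R]
    [CompleteSpace R] (a b : R) (h : ∀ μ : ℂ, IsUnit (a + μ • b)) :
    Differentiable ℂ fun μ : ℂ => Ring.inverse (a + μ • b) := fun μ =>
  DifferentiableAt.inverse (h := fun μ : ℂ => a + μ • b) (by fun_prop) (h μ)

theorem one_sub_volterra₂ (hL : 0 ≤ L) {q : ℝ → ℝ} (hq : IntegrableOn q (Icc 0 L)) (μ : ℂ) :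
    1 - volterra₂ hL (fun t => (q t : ℂ) - μ) (integrableOn_potential hq μ) =
      (1 - volterra₂ hL (fun t => (q t : ℂ)) (integrableOn_ofReal hq)) +
        μ • volterra₂ hL (fun _ => 1) integrableOn_one := by
  rw [volterra₂, volterra_sub hL hq, ContinuousLinearMap.comp_sub, ContinuousLinearMap.comp_smul]
  exact (sub_add (1 : C(Icc (0 : ℝ) L, ℂ) →L[ℂ] C(Icc (0 : ℝ) L, ℂ)) _ _).symm

theorem differentiable_solutionOp (hL : 0 ≤ L) {q : ℝ → ℝ} (hq : IntegrableOn q (Icc 0 L)) :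
    Differentiable ℂ (solutionOp hL hq) := by
  have h := differentiable_inverse_affine
    (1 - volterra₂ hL (fun t => (q t : ℂ)) (integrableOn_ofReal hq))
    (volterra₂ hL (fun _ => 1) integrableOn_one) fun μ => by
      rw [← one_sub_volterra₂ hL hq]
      exact isUnit_one_sub_volterra₂ hL (integrableOn_potential hq μ)
  have he : solutionOp hL hq = fun μ => Ring.inverse
      ((1 - volterra₂ hL (fun t => (q t : ℂ)) (integrableOn_ofReal hq)) +
        μ • volterra₂ hL (fun _ => 1) integrableOn_one) :=
    funext fun μ => by rw [← one_sub_volterra₂ hL hq]; rfl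
  rw [he]
  exact h

/-- The right hand side of the Volterra equation of the initial value problem
`-u'' + q u = μ u + g`, `u 0 = c`, `u' 0 = d`. -/
def initialTerm (hL : 0 ≤ L) {g : ℝ → ℂ} (hg : IntegrableOn g (Icc 0 L)) (c d : ℂ) :
    C(Icc (0 : ℝ) L, ℂ) :=
  c • 1 + d • coordMap L - volterra hL (fun _ => 1) integrableOn_one (primitiveMap g hg)

theorem eq_solutionOp_initialTerm_iff (hL : 0 ≤ L) {q : ℝ → ℝ} (hq : IntegrableOn q (Icc 0 L))
    (μ : ℂ) {g : ℝ → ℂ} (hg : IntegrableOn g (Icc 0 L)) (c d : ℂ) (u : C(Icc (0 : ℝ) L, ℂ)) :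
    u = solutionOp hL hq μ (initialTerm hL hg c d) ↔ ∀ x : Icc (0 : ℝ) L, u x =
      c + ∫ s in 0..(x : ℝ), (d + ∫ t in 0..s, (((q t : ℂ) - μ) * IccExtend hL u t - g t)) := by
  rw [eq_solutionOp_iff, DFunLike.ext_iff]
  refine forall_congr' fun x => ?_
  have hw := integrableOn_mul_IccExtend hL (integrableOn_potential hq μ) u
  have hpu : IntervalIntegrable (fun s => IccExtend hL (volterra hL (fun t => (q t : ℂ) - μ)
      (integrableOn_potential hq μ) u) s) volume 0 x :=
    (ContinuousMap.continuous _).Icc_extend'.intervalIntegrable _ _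
  have hpg : IntervalIntegrable (fun s => IccExtend hL (primitiveMap g hg) s) volume 0 x :=
    (ContinuousMap.continuous _).Icc_extend'.intervalIntegrable _ _
  have key : ∫ s in 0..(x : ℝ), (d + ∫ t in 0..s, (((q t : ℂ) - μ) * IccExtend hL u t - g t)) =
      d * (x : ℝ) + volterra₂ hL (fun t => (q t : ℂ) - μ) (integrableOn_potential hq μ) u x -
        volterra hL (fun _ => 1) integrableOn_one (primitiveMap g hg) x := by
    have h1 : ∫ s in 0..(x : ℝ), (d + ∫ t in 0..s, (((q t : ℂ) - μ) * IccExtend hL u t - g t)) =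
        ∫ s in 0..(x : ℝ), (d + (IccExtend hL (volterra hL (fun t => (q t : ℂ) - μ)
          (integrableOn_potential hq μ) u) s - IccExtend hL (primitiveMap g hg) s)) := by
      refine intervalIntegral.integral_congr fun s hs => ?_
      rw [uIcc_of_le x.2.1] at hs
      have hs' : s ∈ Icc 0 L := ⟨hs.1, hs.2.trans x.2.2⟩
      rw [IccExtend_of_mem hL _ hs', IccExtend_of_mem hL _ hs', volterra_apply,
        primitiveMap_apply, intervalIntegral.integral_sub (hw.intervalIntegrable_zero hs')
          (hg.intervalIntegrable_zero hs')]
    rw [h1, intervalIntegral.integral_add (by simp) (hpu.sub hpg),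
      intervalIntegral.integral_sub hpu hpg]
    simp only [volterra₂, ContinuousLinearMap.comp_apply, volterra_apply, one_mul,
      intervalIntegral.integral_const, sub_zero, Complex.real_smul]
    ring
  rw [key]
  simp only [initialTerm, ContinuousMap.sub_apply, ContinuousMap.add_apply,
    ContinuousMap.smul_apply, ContinuousMap.one_apply, smul_eq_mul, coordMap, ContinuousMap.coe_mk]
  constructor <;> intro h <;> linear_combination h

/-- Existence for the initial value problem. -/
theorem isEdgeSolution_solutionOp (hL : 0 < L) {q : ℝ → ℝ} (hq : IntegrableOn q (Icc 0 L))
    (μ : ℂ) {g : ℝ → ℂ} (hg : IntegrableOn g (Icc 0 L)) (c d : ℂ)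
    {u : C(Icc (0 : ℝ) L, ℂ)} (hu : u = solutionOp hL.le hq μ (initialTerm hL.le hg c d)) :
    IsEdgeSolution L q μ g (IccExtend hL.le u) ∧ IccExtend hL.le u 0 = c ∧
      derivWithin (IccExtend hL.le u) (Icc 0 L) 0 = d ∧
      derivWithin (IccExtend hL.le u) (Icc 0 L) L =
        d + ∫ t in 0..L, (((q t : ℂ) - μ) * IccExtend hL.le u t - g t) := by
  rw [eq_solutionOp_initialTerm_iff] at hu
  have h0 : (0 : ℝ) ∈ Icc 0 L := left_mem_Icc.2 hL.le
  have hw := (integrableOn_mul_IccExtend hL.le (integrableOn_potential hq μ) u)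
  obtain ⟨h1, h2, h3, h4, h5⟩ := ac2_of_eqOn_integral (f := IccExtend hL.le u) hL
    (hw.sub hg) (c := c) (d := d) fun x hx => by
      rw [IccExtend_of_mem hL.le _ hx]; exact hu ⟨x, hx⟩
  refine ⟨⟨⟨h1, h2, h3⟩, ?_⟩, ?_, ?_, h4 L (right_mem_Icc.2 hL.le)⟩
  · filter_upwards [h5] with x hx
    rw [hx, Pi.sub_apply]
    ring
  · rw [IccExtend_of_mem hL.le _ h0, hu]; simp
  · rw [h4 0 h0]; simp

/-- Uniqueness for the initial value problem. -/
theorem IsEdgeSolution.eq_solutionOp (hL : 0 < L) {q : ℝ → ℝ} (hq : IntegrableOn q (Icc 0 L))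
    {μ : ℂ} {g f : ℝ → ℂ} (hg : IntegrableOn g (Icc 0 L)) (hf : IsEdgeSolution L q μ g f) :
    ∀ x : Icc (0 : ℝ) L, f x =
      solutionOp hL.le hq μ (initialTerm hL.le hg (f 0) (derivWithin f (Icc 0 L) 0)) x := by
  have hc : ContinuousOn f (Icc 0 L) := by
    have := hf.1.1.continuousOn
    rwa [uIcc_of_le hL.le] at this
  set u : C(Icc (0 : ℝ) L, ℂ) := ⟨(Icc 0 L).domRestrict f,
    continuousOn_iff_continuous_domRestrict.1 hc⟩ with hu
  have hux : ∀ x ∈ Icc 0 L, IccExtend hL.le u x = f x := fun x hx => by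
    rw [IccExtend_of_mem hL.le _ hx]; rfl
  suffices h : u = solutionOp hL.le hq μ
      (initialTerm hL.le hg (f 0) (derivWithin f (Icc 0 L) 0)) by
    intro x
    rw [← h]; rfl
  rw [eq_solutionOp_initialTerm_iff]
  intro x
  obtain ⟨h1, h2⟩ := eq_integral_of_ac2 hL hf.1.1 hf.1.2.2
  have h3 : u x = f x := rfl
  rw [h3, h2 x x.2]
  congr 1
  refine intervalIntegral.integral_congr fun s hs => ?_
  rw [uIcc_of_le x.2.1] at hs
  congr 1
  refine intervalIntegral.integral_congr_ae ?_
  have h4 := hf.2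
  rw [ae_restrict_iff' measurableSet_Icc] at h4
  filter_upwards [h4] with t ht hts
  rw [uIoc_of_le hs.1] at hts
  have htI : t ∈ Icc 0 L := ⟨hts.1.le, hts.2.trans (hs.2.trans x.2.2)⟩
  rw [hux t htI]
  linear_combination -(ht htI)

end InitialValueProblem

namespace MetricGraph

/-! ### The vertex conditions as a square linear system -/

section BoundaryMap

variable {V E : Type*} (G : MetricGraph V E)

/-- The endpoint at which `vertexValue` reads off the value at `v`. -/
def rep (v : V) : E × Bool := (G.exists_endVertex_eq v).choose

theorem endVertex_rep (v : V) : G.endVertex (G.rep v) = v := (G.exists_endVertex_eq v).choose_spec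

theorem vertexValue_eq (u : E → ℝ → ℂ) (v : V) :
    G.vertexValue u v = u (G.rep v).1 (G.endCoord (G.rep v)) := rfl

theorem endCoord_mem (p : E × Bool) : G.endCoord p ∈ G.edge p.1 := by
  rcases p with ⟨e, _ | _⟩
  · exact left_mem_Icc.2 (G.length_pos e).le
  · exact right_mem_Icc.2 (G.length_pos e).le

open Classical in
/-- The right hand side of the linear system for the data `h` of the `δ`-conditions. -/
def boundaryData (h : V → ℂ) (p : E × Bool) : ℂ :=
  if p = G.rep (G.endVertex p) then h (G.endVertex p) else 0

theorem boundaryData_zero : G.boundaryData (0 : V → ℂ) = 0 := by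
  funext p; simp [boundaryData]

variable [Fintype E]

open Classical in
/-- All vertex conditions in one vector indexed by the endpoints: at the representative endpoint of
a vertex the defect of the `δ`-condition, at every other endpoint the jump of the function with
respect to the representative. -/
def boundaryMap (α : V → ℝ) (u : E → ℝ → ℂ) (p : E × Bool) : ℂ :=
  if p = G.rep (G.endVertex p) then G.deltaDefect α u (G.endVertex p)
  else u p.1 (G.endCoord p) - G.vertexValue u (G.endVertex p)

theorem boundaryMap_add (α : V → ℝ) {u w : E → ℝ → ℂ} (hu : G.IsAC2 u) (hw : G.IsAC2 w) :
    G.boundaryMap α (u + w) = G.boundaryMap α u + G.boundaryMap α w := by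
  funext p
  simp only [boundaryMap, Pi.add_apply, deltaDefect_add α hu hw, vertexValue_eq]
  split_ifs
  · rfl
  · ring

theorem boundaryMap_smul (α : V → ℝ) (c : ℂ) (u : E → ℝ → ℂ) :
    G.boundaryMap α (c • u) = c • G.boundaryMap α u := by
  funext p
  simp only [boundaryMap, Pi.smul_apply, deltaDefect_smul, vertexValue_eq, smul_eq_mul]
  split_ifs
  · rfl
  · ring

theorem boundaryMap_eq_boundaryData_iff (α : V → ℝ) {u : E → ℝ → ℂ} (hu : G.IsAC2 u)
    (h : V → ℂ) : G.boundaryMap α u = G.boundaryData h ↔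
      G.IsContinuous u ∧ ∀ v, G.deltaDefect α u v = h v := by
  have hc : ∀ e, ContinuousOn (u e) (G.edge e) := fun e => (hu e).2.1.continuousOn
  constructor
  · intro H
    have hval : ∀ p, u p.1 (G.endCoord p) = G.vertexValue u (G.endVertex p) := fun p => by
      by_cases hp : p = G.rep (G.endVertex p)
      · rw [vertexValue_eq, ← hp]
      · have := congrFun H p
        simp only [boundaryMap, boundaryData, if_neg hp] at this
        exact sub_eq_zero.1 this
    refine ⟨⟨hc, fun p p' hpp => by rw [hval p, hval p', hpp]⟩, fun v => ?_⟩
    have := congrFun H (G.rep v)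
    simpa only [boundaryMap, boundaryData, endVertex_rep, if_true] using this
  · rintro ⟨h1, h2⟩
    funext p
    simp only [boundaryMap, boundaryData, h2]
    split_ifs with hp
    · rfl
    · rw [G.vertexValue_endVertex h1 p, sub_self]

end BoundaryMap

/-! ### Solutions on the edges, parametrized by their Cauchy data -/

section CauchyData

variable {V E : Type*} (G : MetricGraph V E) {q : E → ℝ → ℝ}
  (hq : ∀ e, IntegrableOn (q e) (Icc 0 (G.length e)))

/-- The solution of `-u'' + q u = μ u` on the edge `e` with `u 0 = x (e, false)` and
`u' 0 = x (e, true)`, as an element of `C([0, L])`. -/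
def edgeSolution (μ : ℂ) (e : E) : (E × Bool → ℂ) →ₗ[ℂ] C(G.edge e, ℂ) where
  toFun x := solutionOp (G.length_pos e).le (hq e) μ
    (x (e, false) • 1 + x (e, true) • coordMap (G.length e))
  map_add' x y := by
    rw [← map_add]; congr 1; simp only [Pi.add_apply]; module
  map_smul' c x := by
    rw [RingHom.id_apply, ← map_smul]; congr 1; simp only [Pi.smul_apply]; module

/-- The function on the graph whose restriction to the edge `e` is `edgeSolution μ e x`. -/
def solutionFun (μ : ℂ) (x : E × Bool → ℂ) (e : E) : ℝ → ℂ :=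
  IccExtend (G.length_pos e).le (G.edgeSolution hq μ e x)

/-- The Cauchy data at the initial endpoints of the edges. -/
def cauchyData (u : E → ℝ → ℂ) (p : E × Bool) : ℂ :=
  bif p.2 then G.D p.1 (u p.1) 0 else u p.1 0

theorem solutionFun_add (μ : ℂ) (x y : E × Bool → ℂ) :
    G.solutionFun hq μ (x + y) = G.solutionFun hq μ x + G.solutionFun hq μ y := by
  funext e t
  simp only [solutionFun, map_add, Pi.add_apply]
  rfl

theorem solutionFun_smul (μ c : ℂ) (x : E × Bool → ℂ) :
    G.solutionFun hq μ (c • x) = c • G.solutionFun hq μ x := by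
  funext e t
  simp only [solutionFun, map_smul, Pi.smul_apply]
  rfl

theorem initialTerm_zero {L : ℝ} (hL : 0 ≤ L) (c d : ℂ) :
    initialTerm hL (g := fun _ => 0) (integrableOn_zero) c d = c • 1 + d • coordMap L := by
  have : primitiveMap (L := L) (fun _ => 0) integrableOn_zero = 0 := by
    ext x; simp [primitiveMap_apply]
  rw [initialTerm, this, map_zero, sub_zero]

theorem edgeSolution_eq (μ : ℂ) (e : E) (x : E × Bool → ℂ) :
    G.edgeSolution hq μ e x = solutionOp (G.length_pos e).le (hq e) μ
      (initialTerm (G.length_pos e).le (g := fun _ => 0) integrableOn_zero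
        (x (e, false)) (x (e, true))) := by
  rw [initialTerm_zero]; rfl

theorem solutionFun_of_mem (μ : ℂ) (x : E × Bool → ℂ) {e : E} {t : ℝ} (ht : t ∈ G.edge e) :
    G.solutionFun hq μ x e t = G.edgeSolution hq μ e x ⟨t, ht⟩ :=
  IccExtend_of_mem _ _ ht

theorem continuous_solutionFun (μ : ℂ) (x : E × Bool → ℂ) (e : E) :
    Continuous (G.solutionFun hq μ x e) :=
  (ContinuousMap.continuous _).Icc_extend'

theorem isAC2_solutionFun (μ : ℂ) (x : E × Bool → ℂ) : G.IsAC2 (G.solutionFun hq μ x) := fun e =>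
  (isEdgeSolution_solutionOp (G.length_pos e) (hq e) μ integrableOn_zero _ _
    (G.edgeSolution_eq hq μ e x)).1.1

theorem schrodinger_solutionFun (μ : ℂ) (x : E × Bool → ℂ) (e : E) :
    ∀ᵐ t ∂volume.restrict (G.edge e),
      G.schrodinger q (G.solutionFun hq μ x) e t = μ * G.solutionFun hq μ x e t := by
  have := (isEdgeSolution_solutionOp (G.length_pos e) (hq e) μ integrableOn_zero _ _
    (G.edgeSolution_eq hq μ e x)).1.2
  filter_upwards [this] with t ht
  rw [add_zero] at ht
  exact ht

theorem cauchyData_solutionFun (μ : ℂ) (x : E × Bool → ℂ) :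
    G.cauchyData (G.solutionFun hq μ x) = x := by
  funext p
  obtain ⟨-, h0, h1, -⟩ := isEdgeSolution_solutionOp (G.length_pos p.1) (hq p.1) μ
    integrableOn_zero _ _ (G.edgeSolution_eq hq μ p.1 x)
  rcases p with ⟨e, _ | _⟩
  · exact h0
  · exact h1

theorem D_solutionFun_length (μ : ℂ) (x : E × Bool → ℂ) (e : E) :
    G.D e (G.solutionFun hq μ x e) (G.length e) = x (e, true) +
      volterra (G.length_pos e).le (fun t => (q e t : ℂ) - μ) (integrableOn_potential (hq e) μ)
        (G.edgeSolution hq μ e x) ⟨G.length e, right_mem_Icc.2 (G.length_pos e).le⟩ := by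
  obtain ⟨-, -, -, h⟩ := isEdgeSolution_solutionOp (G.length_pos e) (hq e) μ
    integrableOn_zero _ _ (G.edgeSolution_eq hq μ e x)
  refine h.trans ?_
  simp only [sub_zero]
  rfl

theorem D_solutionFun_zero (μ : ℂ) (x : E × Bool → ℂ) (e : E) :
    G.D e (G.solutionFun hq μ x e) 0 = x (e, true) :=
  congrFun (G.cauchyData_solutionFun hq μ x) (e, true)

theorem solutionFun_zero (μ : ℂ) (x : E × Bool → ℂ) (e : E) :
    G.solutionFun hq μ x e 0 = x (e, false) :=
  congrFun (G.cauchyData_solutionFun hq μ x) (e, false)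

/-- A solution is determined by its Cauchy data. -/
theorem eqOn_solutionFun {μ : ℂ} {u : E → ℝ → ℂ} (hu : G.IsAC2 u)
    (h : ∀ e, ∀ᵐ t ∂volume.restrict (G.edge e), G.schrodinger q u e t = μ * u e t) (e : E) :
    EqOn (u e) (G.solutionFun hq μ (G.cauchyData u) e) (G.edge e) := by
  intro t ht
  have hs : IsEdgeSolution (G.length e) (q e) μ (fun _ => 0) (u e) :=
    ⟨hu e, by filter_upwards [h e] with t ht; rw [add_zero]; exact ht⟩
  rw [solutionFun_of_mem G hq _ _ ht, edgeSolution_eq]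
  exact hs.eq_solutionOp (G.length_pos e) (hq e) integrableOn_zero ⟨t, ht⟩

/-- The inhomogeneous equation is solvable on the edges, disregarding vertex conditions. -/
theorem exists_inhomogeneous_solution
    (hq : ∀ e, IntegrableOn (q e) (Icc 0 (G.length e))) (μ : ℂ) {g : E → ℝ → ℂ}
    (hg : ∀ e, IntegrableOn (g e) (G.edge e)) : ∃ u, G.IsAC2 u ∧
      ∀ e, ∀ᵐ t ∂volume.restrict (G.edge e), G.schrodinger q u e t = μ * u e t + g e t := by
  have H := fun e => isEdgeSolution_solutionOp (G.length_pos e) (hq e) μ (hg e) 0 0 rfl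
  exact ⟨fun e => IccExtend (G.length_pos e).le _, fun e => (H e).1.1, fun e => (H e).1.2⟩

theorem differentiable_edgeSolution (x : E × Bool → ℂ) (e : E) :
    Differentiable ℂ fun μ => G.edgeSolution hq μ e x :=
  (differentiable_solutionOp (G.length_pos e).le (hq e)).clm_apply (differentiable_const _)

theorem differentiable_solutionFun (x : E × Bool → ℂ) {e : E} {t : ℝ} (ht : t ∈ G.edge e) :
    Differentiable ℂ fun μ => G.solutionFun hq μ x e t := by
  simp only [solutionFun_of_mem G hq _ _ ht]
  exact (ContinuousMap.evalCLM ℂ (⟨t, ht⟩ : G.edge e)).differentiable.comp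
    (G.differentiable_edgeSolution hq x e)

theorem differentiable_D_solutionFun_length (x : E × Bool → ℂ) (e : E) :
    Differentiable ℂ fun μ => G.D e (G.solutionFun hq μ x e) (G.length e) := by
  have h1 := (differentiable_volterra (G.length_pos e).le (hq e)).clm_apply
    (G.differentiable_edgeSolution hq x e)
  have h2 := (ContinuousMap.evalCLM ℂ
    (⟨G.length e, right_mem_Icc.2 (G.length_pos e).le⟩ : G.edge e)).differentiable.comp h1
  simp only [D_solutionFun_length]
  exact (differentiable_const _).add h2

variable [Fintype E]

theorem differentiable_boundaryMap_solutionFun (α : V → ℝ) (x : E × Bool → ℂ) (p : E × Bool) :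
    Differentiable ℂ fun μ => G.boundaryMap α (G.solutionFun hq μ x) p := by
  classical
  have hv : ∀ v, Differentiable ℂ fun μ => G.vertexValue (G.solutionFun hq μ x) v := fun v =>
    G.differentiable_solutionFun hq x (G.endCoord_mem _)
  have hD : ∀ v, Differentiable ℂ fun μ => G.normalDeriv (G.solutionFun hq μ x) v := fun v => by
    unfold normalDeriv
    refine (Differentiable.fun_sum fun e _ => ?_).sub (Differentiable.fun_sum fun e _ => ?_)
    · split_ifs
      · exact G.differentiable_D_solutionFun_length hq x e
      · exact differentiable_const _
    · simp only [D_solutionFun_zero]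
      exact differentiable_const _
  unfold boundaryMap
  split_ifs
  · exact (hD _).sub ((hv _).const_mul _)
  · exact (G.differentiable_solutionFun hq x (G.endCoord_mem _)).sub (hv _)

/-- The vertex conditions as a function of the Cauchy data of a solution of `-u'' + q u = μ u`. -/
def characteristicMap (α : V → ℝ) (μ : ℂ) : (E × Bool → ℂ) →ₗ[ℂ] (E × Bool → ℂ) where
  toFun x := G.boundaryMap α (G.solutionFun hq μ x)
  map_add' x y := by
    rw [solutionFun_add, boundaryMap_add G α (isAC2_solutionFun G hq μ x)
      (isAC2_solutionFun G hq μ y)]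
  map_smul' c x := by
    rw [solutionFun_smul, boundaryMap_smul, RingHom.id_apply]

theorem characteristicMap_apply (α : V → ℝ) (μ : ℂ) (x : E × Bool → ℂ) :
    G.characteristicMap hq α μ x = G.boundaryMap α (G.solutionFun hq μ x) := rfl

theorem isSolution_solutionFun_iff (α : V → ℝ) (μ : ℂ) (h : V → ℂ) (x : E × Bool → ℂ) :
    G.IsSolution q α μ h (G.solutionFun hq μ x) ↔
      G.characteristicMap hq α μ x = G.boundaryData h := by
  rw [characteristicMap_apply,
    boundaryMap_eq_boundaryData_iff G α (isAC2_solutionFun G hq μ x)]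
  exact ⟨fun H => H.2.2, fun H => ⟨isAC2_solutionFun G hq μ x,
    schrodinger_solutionFun G hq μ x, H⟩⟩

end CauchyData

section Congruence

variable {V E : Type*} (G : MetricGraph V E) {u w : E → ℝ → ℂ}

theorem IsAC2.congr (hu : G.IsAC2 u) (h : ∀ e, EqOn (u e) (w e) (G.edge e)) : G.IsAC2 w :=
  fun e => ⟨ac_congr (G.length_pos e).le (h e) (hu e).1,
    (hu e).2.1.congr fun _ hx => (h e hx).symm,
    ac_congr (G.length_pos e).le (D_congr (h e)) (hu e).2.2⟩

theorem schrodinger_congr (q : E → ℝ → ℝ) (h : ∀ e, EqOn (u e) (w e) (G.edge e)) (e : E) :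
    EqOn (G.schrodinger q u e) (G.schrodinger q w e) (G.edge e) := fun x hx => by
  simp only [schrodinger]
  rw [h e hx, D_congr (D_congr (h e)) hx]

theorem vertexValue_congr (h : ∀ e, EqOn (u e) (w e) (G.edge e)) (v : V) :
    G.vertexValue u v = G.vertexValue w v :=
  h _ (G.endCoord_mem _)

variable [Fintype E]

theorem boundaryMap_congr (α : V → ℝ) (h : ∀ e, EqOn (u e) (w e) (G.edge e)) :
    G.boundaryMap α u = G.boundaryMap α w := by
  have h0 : ∀ e, G.D e (u e) 0 = G.D e (w e) 0 := fun e =>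
    D_congr (h e) (left_mem_Icc.2 (G.length_pos e).le)
  have h1 : ∀ e, G.D e (u e) (G.length e) = G.D e (w e) (G.length e) := fun e =>
    D_congr (h e) (right_mem_Icc.2 (G.length_pos e).le)
  funext p
  simp only [boundaryMap, deltaDefect, normalDeriv, G.vertexValue_congr h, h0, h1,
    h p.1 (G.endCoord_mem p)]

end Congruence

/-! ### Lagrange's identity -/

section Lagrange

variable {V E : Type*} (G : MetricGraph V E) {q : E → ℝ → ℝ} {u w : E → ℝ → ℂ}

theorem ae_differentiableWithinAt_D (hu : G.IsAC2 u) (e : E) :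
    ∀ᵐ x ∂volume.restrict (G.edge e), DifferentiableWithinAt ℝ (G.D e (u e)) (G.edge e) x := by
  have := (hu e).2.2.boundedVariationOn
  rw [uIcc_of_le (G.length_pos e).le] at this
  exact this.locallyBoundedVariationOn.ae_differentiableWithinAt measurableSet_Icc

/-- Lagrange's identity on an edge. -/
theorem integral_edge_lagrange (q : E → ℝ → ℝ) (hu : G.IsAC2 u) (hw : G.IsAC2 w) (e : E) :
    ∫ t in G.edge e, (G.schrodinger q u e t * w e t - u e t * G.schrodinger q w e t) =
      (u e (G.length e) * G.D e (w e) (G.length e) - u e 0 * G.D e (w e) 0) -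
        (G.D e (u e) (G.length e) * w e (G.length e) - G.D e (u e) 0 * w e 0) := by
  have hL := G.length_pos e
  have hac := ((hu e).1.smul (hw e).2.2).sub ((hu e).2.2.smul (hw e).1)
  have h1 : u e (G.length e) * G.D e (w e) (G.length e) -
      G.D e (u e) (G.length e) * w e (G.length e) = u e 0 * G.D e (w e) 0 -
      G.D e (u e) 0 * w e 0 + ∫ t in 0..G.length e, derivWithin (u e • G.D e (w e) -
        G.D e (u e) • w e) (Icc 0 (G.length e)) t :=
    (hac.integral_derivWithin hL).2 _ (right_mem_Icc.2 hL.le)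
  have h2 : ∫ t in G.edge e, (G.schrodinger q u e t * w e t - u e t * G.schrodinger q w e t) =
      ∫ t in 0..G.length e, derivWithin (u e • G.D e (w e) -
        G.D e (u e) • w e) (Icc 0 (G.length e)) t := by
    rw [intervalIntegral.integral_of_le hL.le, ← integral_Icc_eq_integral_Ioc]
    refine setIntegral_congr_ae measurableSet_Icc ?_
    have hu1 := G.ae_differentiableWithinAt_D hu e
    have hw1 := G.ae_differentiableWithinAt_D hw e
    rw [ae_restrict_iff' measurableSet_Icc] at hu1 hw1
    filter_upwards [hu1, hw1] with t htu htw ht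
    have hud := ((hu e).2.1 t ht).hasDerivWithinAt
    have hwd := ((hw e).2.1 t ht).hasDerivWithinAt
    have := (hud.mul (htw ht).hasDerivWithinAt).sub ((htu ht).hasDerivWithinAt.mul hwd)
    rw [smul_eq_mul, smul_eq_mul]
    refine Eq.trans ?_ (this.derivWithin (uniqueDiffOn_Icc hL t ht)).symm
    simp only [schrodinger, D]
    ring
  rw [h2]
  linear_combination -h1

variable [Fintype E] [Fintype V]

theorem sum_vertexValue_mul_normalDeriv (hu : G.IsContinuous u) (w : E → ℝ → ℂ) :
    ∑ v, G.vertexValue u v * G.normalDeriv w v =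
      ∑ e, (u e (G.length e) * G.D e (w e) (G.length e) - u e 0 * G.D e (w e) 0) := by
  classical
  have h1 : ∀ e, G.vertexValue u (G.term e) = u e (G.length e) := fun e =>
    G.vertexValue_endVertex hu (e, true)
  have h0 : ∀ e, G.vertexValue u (G.init e) = u e 0 := fun e =>
    G.vertexValue_endVertex hu (e, false)
  simp only [normalDeriv, mul_sub, Finset.sum_sub_distrib, Finset.mul_sum]
  rw [Finset.sum_comm, Finset.sum_comm (f := fun v e => G.vertexValue u v *
    if G.init e = v then G.D e (w e) 0 else 0)]
  simp [h0, h1]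

/-- **Lagrange's identity** (Green's formula) on the graph. -/
theorem lagrange_identity (q : E → ℝ → ℝ) (α : V → ℝ) (hu : G.IsAC2 u) (hw : G.IsAC2 w)
    (huc : G.IsContinuous u) (hwc : G.IsContinuous w) :
    ∑ e, ∫ t in G.edge e, (G.schrodinger q u e t * w e t - u e t * G.schrodinger q w e t) =
      ∑ v, (G.vertexValue u v * G.deltaDefect α w v -
        G.deltaDefect α u v * G.vertexValue w v) := by
  have h1 := G.sum_vertexValue_mul_normalDeriv huc w
  have h2 := G.sum_vertexValue_mul_normalDeriv hwc u
  simp only [G.integral_edge_lagrange q hu hw]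
  have h3 : ∀ v, G.vertexValue u v * G.deltaDefect α w v -
      G.deltaDefect α u v * G.vertexValue w v =
      G.vertexValue u v * G.normalDeriv w v - G.vertexValue w v * G.normalDeriv u v := fun v => by
    simp only [deltaDefect]; ring
  simp only [h3]
  rw [Finset.sum_sub_distrib (f := fun v => G.vertexValue u v * G.normalDeriv w v), h1, h2,
    ← Finset.sum_sub_distrib]
  exact Finset.sum_congr rfl fun e _ => by ring

/-- Lagrange's identity for solutions at two spectral parameters. -/
theorem IsSolution.lagrange {α : V → ℝ} {μ ν : ℂ} {h k : V → ℂ} (hu : G.IsSolution q α μ h u)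
    (hw : G.IsSolution q α ν k w) :
    (μ - ν) * ∑ e, ∫ t in G.edge e, u e t * w e t =
      ∑ v, (G.vertexValue u v * k v - h v * G.vertexValue w v) := by
  have := G.lagrange_identity q α hu.1 hw.1 hu.2.2.1 hw.2.2.1
  simp only [hu.2.2.2, hw.2.2.2] at this
  rw [← this, Finset.mul_sum]
  refine Finset.sum_congr rfl fun e _ => ?_
  rw [← integral_const_mul]
  refine integral_congr_ae ?_
  filter_upwards [hu.2.1 e, hw.2.1 e] with t h1 h2
  rw [h1, h2]; ring

end Lagrange

/-! ### Complex conjugation -/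

section Conjugation

variable {V E : Type*} (G : MetricGraph V E) {q : E → ℝ → ℝ} {u w : E → ℝ → ℂ}

/-- The complex conjugate of a function on the graph. -/
def conjFun (u : E → ℝ → ℂ) (e : E) (t : ℝ) : ℂ := (starRingEnd ℂ) (u e t)

theorem D_conj (e : E) (f : ℝ → ℂ) :
    G.D e (fun t => (starRingEnd ℂ) (f t)) = fun t => (starRingEnd ℂ) (G.D e f t) := by
  funext t
  exact derivWithin.star

theorem IsAC2.conj (hu : G.IsAC2 u) : G.IsAC2 (conjFun u) := fun e => by
  refine ⟨(hu e).1.conj, (hu e).2.1.star, ?_⟩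
  have : G.D e (conjFun u e) = fun t => (starRingEnd ℂ) (G.D e (u e) t) := G.D_conj e (u e)
  rw [this]
  exact (hu e).2.2.conj

theorem IsContinuous.conj (hu : G.IsContinuous u) : G.IsContinuous (conjFun u) :=
  ⟨fun e => (hu.1 e).star, fun p p' h => congrArg (starRingEnd ℂ) (hu.2 p p' h)⟩

theorem schrodinger_conj (q : E → ℝ → ℝ) (u : E → ℝ → ℂ) (e : E) (t : ℝ) :
    G.schrodinger q (conjFun u) e t = (starRingEnd ℂ) (G.schrodinger q u e t) := by
  have h : G.D e (conjFun u e) = fun t => (starRingEnd ℂ) (G.D e (u e) t) := G.D_conj e (u e)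
  simp only [schrodinger, h, D_conj, conjFun, map_add, map_neg, map_mul, Complex.conj_ofReal]

theorem vertexValue_conj (u : E → ℝ → ℂ) (v : V) :
    G.vertexValue (conjFun u) v = (starRingEnd ℂ) (G.vertexValue u v) := rfl

theorem deltaDefect_conj [Fintype E] (α : V → ℝ) (u : E → ℝ → ℂ) (v : V) :
    G.deltaDefect α (conjFun u) v = (starRingEnd ℂ) (G.deltaDefect α u v) := by
  have h : ∀ e, G.D e (conjFun u e) = fun t => (starRingEnd ℂ) (G.D e (u e) t) :=
    fun e => G.D_conj e (u e)
  have h2 : ∀ (P : Prop) [Decidable P] (a : ℂ),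
      (starRingEnd ℂ) (if P then a else 0) = if P then (starRingEnd ℂ) a else 0 := by
    intro P _ a; split_ifs <;> simp
  simp only [deltaDefect, normalDeriv, h, vertexValue_conj, map_sub, map_mul, map_sum, h2,
    Complex.conj_ofReal]

theorem IsSolution.conj [Fintype E] {α : V → ℝ} {μ : ℂ} {h : V → ℂ}
    (hu : G.IsSolution q α μ h u) :
    G.IsSolution q α ((starRingEnd ℂ) μ) (fun v => (starRingEnd ℂ) (h v)) (conjFun u) := by
  refine ⟨hu.1.conj, fun e => ?_, hu.2.2.1.conj, fun v => ?_⟩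
  · filter_upwards [hu.2.1 e] with t ht
    rw [schrodinger_conj, ht, map_mul]; rfl
  · rw [deltaDefect_conj, hu.2.2.2]

/-- A function that is continuous on the edges and orthogonal to itself is zero. -/
theorem eqOn_zero_of_integral_mul_conj [Fintype E] (hu : ∀ e, ContinuousOn (u e) (G.edge e))
    (h : ∑ e, ∫ t in G.edge e, u e t * conjFun u e t = 0) (e : E) : EqOn (u e) 0 (G.edge e) := by
  have h1 : ∀ e, ∫ t in G.edge e, u e t * conjFun u e t =
      ((∫ t in G.edge e, Complex.normSq (u e t) : ℝ) : ℂ) := fun e => by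
    rw [← integral_complex_ofReal]
    exact integral_congr_ae (ae_of_all _ fun t => Complex.mul_conj _)
  simp only [h1] at h
  rw [← Complex.ofReal_sum, Complex.ofReal_eq_zero, Finset.sum_eq_zero_iff_of_nonneg
    fun e _ => integral_nonneg fun t => Complex.normSq_nonneg _] at h
  have h2 := h e (Finset.mem_univ _)
  have hc : ContinuousOn (fun t => Complex.normSq (u e t)) (G.edge e) :=
    Complex.continuous_normSq.comp_continuousOn (hu e)
  rw [integral_eq_zero_iff_of_nonneg (fun t => Complex.normSq_nonneg _)
    hc.integrableOn_Icc] at h2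
  refine Measure.eqOn_Icc_of_ae_eq volume (G.length_pos e).ne ?_ (hu e) continuousOn_const
  filter_upwards [h2] with t ht
  exact Complex.normSq_eq_zero.1 ht

/-- Non-real numbers are not eigenvalues. -/
theorem IsSolution.eqOn_zero_of_im_ne_zero [Fintype E] [Fintype V] {α : V → ℝ} {μ : ℂ}
    (hμ : μ.im ≠ 0) (hu : G.IsSolution q α μ 0 u) (e : E) : EqOn (u e) 0 (G.edge e) := by
  refine G.eqOn_zero_of_integral_mul_conj hu.2.2.1.1 ?_ e
  have h := IsSolution.lagrange G hu (IsSolution.conj G hu)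
  simp only [Pi.zero_apply, map_zero, mul_zero, zero_mul, sub_zero, Finset.sum_const_zero] at h
  refine (mul_eq_zero.1 h).resolve_left fun h0 => hμ ?_
  have := congrArg Complex.im h0
  simp only [Complex.sub_im, Complex.conj_im, Complex.zero_im] at this
  linarith

end Conjugation

/-! ### The characteristic determinant -/

section Characteristic

variable {V E : Type*} (G : MetricGraph V E)

theorem cauchyData_congr {u w : E → ℝ → ℂ} (h : ∀ e, EqOn (u e) (w e) (G.edge e)) :
    G.cauchyData u = G.cauchyData w := by
  funext p
  have h0 : (0 : ℝ) ∈ G.edge p.1 := left_mem_Icc.2 (G.length_pos p.1).le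
  rcases p with ⟨e, _ | _⟩
  · exact h e h0
  · exact D_congr (h e) h0

theorem cauchyData_zero : G.cauchyData (0 : E → ℝ → ℂ) = 0 := by
  funext p
  have hD : ∀ e, G.D e (0 : ℝ → ℂ) = 0 := fun e => by
    simpa using D_smul (G := G) (e := e) 0 0
  rcases p with ⟨e, _ | _⟩ <;> simp [cauchyData, hD]

theorem eq_zero_of_solutionFun_eqOn_zero {q : E → ℝ → ℝ}
    (hq : ∀ e, IntegrableOn (q e) (Icc 0 (G.length e))) {μ : ℂ} {x : E × Bool → ℂ}
    (h : ∀ e, EqOn (G.solutionFun hq μ x e) 0 (G.edge e)) : x = 0 := by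
  rw [← G.cauchyData_solutionFun hq μ x, ← G.cauchyData_zero]
  exact G.cauchyData_congr h

end Characteristic

section Characteristic

variable {V E : Type*} [Fintype E] (G : MetricGraph V E) {q : E → ℝ → ℝ}
  (hq : ∀ e, IntegrableOn (q e) (Icc 0 (G.length e)))

theorem IsSolution.characteristicMap_cauchyData {α : V → ℝ} {μ : ℂ} {h : V → ℂ} {u : E → ℝ → ℂ}
    (hq : ∀ e, IntegrableOn (q e) (Icc 0 (G.length e))) (hu : G.IsSolution q α μ h u) :
    G.characteristicMap hq α μ (G.cauchyData u) = G.boundaryData h := by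
  rw [characteristicMap_apply, ← G.boundaryMap_congr α (G.eqOn_solutionFun hq hu.1 hu.2.1),
    boundaryMap_eq_boundaryData_iff G α hu.1]
  exact hu.2.2

variable [DecidableEq E]

/-- The matrix of the system of vertex conditions. It is entire in the spectral parameter, and its
determinant vanishes exactly at the eigenvalues. -/
def characteristicMatrix (α : V → ℝ) (μ : ℂ) : Matrix (E × Bool) (E × Bool) ℂ :=
  LinearMap.toMatrix' (G.characteristicMap hq α μ)

theorem characteristicMatrix_mulVec (α : V → ℝ) (μ : ℂ) (x : E × Bool → ℂ) :
    (G.characteristicMatrix hq α μ).mulVec x = G.characteristicMap hq α μ x :=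
  LinearMap.toMatrix'_mulVec _ _

theorem differentiable_characteristicMatrix (α : V → ℝ) (i j : E × Bool) :
    Differentiable ℂ fun μ => G.characteristicMatrix hq α μ i j := by
  simp only [characteristicMatrix, LinearMap.toMatrix'_apply]
  exact G.differentiable_boundaryMap_solutionFun hq α _ i

theorem det_characteristicMatrix_ne_zero [Fintype V] (α : V → ℝ) {μ : ℂ} (hμ : μ.im ≠ 0) :
    (G.characteristicMatrix hq α μ).det ≠ 0 := by
  intro h
  obtain ⟨x, hx0, hx⟩ := Matrix.exists_mulVec_eq_zero_iff.2 h
  rw [characteristicMatrix_mulVec, ← G.boundaryData_zero (V := V),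
    ← isSolution_solutionFun_iff] at hx
  exact hx0 (G.eq_zero_of_solutionFun_eqOn_zero hq
    (IsSolution.eqOn_zero_of_im_ne_zero G hμ hx))

end Characteristic

end MetricGraph

/-! ### Resolvent set and eigenspaces -/

section Abstract

variable {H : Type*} [NormedAddCommGroup H] [InnerProductSpace ℂ H]

theorem LinearPMap.mem_eigenspace_iff (T : H →ₗ.[ℂ] H) (z : ℂ) (x : H) :
    x ∈ T.eigenspace z ↔ (x, z • x) ∈ T.graph := Iff.rfl

/-- If `T` is symmetric, `T - z` is injective, and `T - z` and `T - conj z` are surjective, then `z`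
is in the resolvent set: by symmetry the inverse has a closed graph, so it is bounded. -/
theorem LinearPMap.mem_resolventSet_of_symmetric [CompleteSpace H] (T : H →ₗ.[ℂ] H) (z : ℂ)
    (hsymm : ∀ p ∈ T.graph, ∀ p' ∈ T.graph, inner ℂ p.2 p'.1 = inner ℂ p.1 p'.2)
    (hinj : ∀ x, (x, z • x) ∈ T.graph → x = 0)
    (hsurj : ∀ y, ∃ x, (x, z • x + y) ∈ T.graph)
    (hsurj' : ∀ y, ∃ x, (x, (starRingEnd ℂ) z • x + y) ∈ T.graph) : z ∈ T.resolventSet := by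
  have huniq : ∀ {x x' y : H}, (x, z • x + y) ∈ T.graph → (x', z • x' + y) ∈ T.graph → x = x' := by
    intro x x' y h h'
    refine sub_eq_zero.1 (hinj _ ?_)
    have := T.graph.sub_mem h h'
    rw [Prod.mk_sub_mk] at this
    convert this using 2
    rw [smul_sub]; abel
  choose R hR using hsurj
  let Rl : H →ₗ[ℂ] H :=
    { toFun := R
      map_add' := fun y y' => huniq (hR _) (by
        have := T.graph.add_mem (hR y) (hR y')
        rw [Prod.mk_add_mk] at this
        convert this using 2
        rw [smul_add]; abel)
      map_smul' := fun c y => huniq (hR _) (by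
        have := T.graph.smul_mem c (hR y)
        rwa [Prod.smul_mk, smul_add, smul_comm c z] at this) }
  -- closed graph: pair the limit with an arbitrary `g` and move `R` to the other side
  have hcont : Continuous Rl := by
    refine Rl.continuous_of_seq_closed_graph fun f x y hf hRf => ?_
    refine ext_inner_right ℂ fun g => ?_
    obtain ⟨w, hw⟩ := hsurj' g
    have key : ∀ f, inner ℂ (R f) g = inner ℂ f w := fun f => by
      have h := hsymm _ (hR f) _ hw
      simp only [inner_add_left, inner_add_right, inner_smul_left, inner_smul_right] at h
      linear_combination -h
    have h1 : Tendsto (fun n => inner ℂ (R (f n)) g) atTop (𝓝 (inner ℂ y g)) :=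
      hRf.inner tendsto_const_nhds
    have h2 : Tendsto (fun n => inner ℂ (R (f n)) g) atTop (𝓝 (inner ℂ x w)) := by
      simp only [key]
      exact hf.inner tendsto_const_nhds
    rw [tendsto_nhds_unique h1 h2]
    exact (key x).symm
  refine ⟨⟨Rl, hcont⟩, fun y => ?_, fun x => ?_⟩
  · obtain ⟨x, hx1, hx2⟩ := (T.mem_graph_iff).1 (hR y)
    have hx1' : (x : H) = R y := hx1
    have hmem : R y ∈ T.domain := hx1' ▸ x.2
    have hx : x = ⟨R y, hmem⟩ := Subtype.ext hx1'
    refine ⟨hmem, ?_⟩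
    rw [hx] at hx2
    change T ⟨R y, hmem⟩ - z • R y = y
    rw [hx2]
    simp
  · refine huniq (hR _) ?_
    simp

end Abstract

namespace MetricGraph

section Operator

theorem memLp_of_continuousOn {V E : Type*} (G : MetricGraph V E) {e : E} {f : ℝ → ℂ}
    (hf : ContinuousOn f (G.edge e)) :
    MemLp f 2 (volume.restrict (G.edge e)) := by
  obtain ⟨C, hC⟩ := isCompact_Icc.exists_bound_of_continuousOn hf
  exact MemLp.of_bound (hf.aestronglyMeasurable measurableSet_Icc) C
    ((ae_restrict_mem measurableSet_Icc).mono hC)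

variable {V E : Type*} [Fintype E] (G : MetricGraph V E) {q : E → ℝ → ℝ}

theorem integrable_L2 (g : G.L2) (e : E) : IntegrableOn (g e) (G.edge e) :=
  (Lp.memLp (g e)).integrable one_le_two

/-- The class in `L²(G)` of a function that is continuous on the edges. -/
def toL2 (u : E → ℝ → ℂ) (hu : ∀ e, ContinuousOn (u e) (G.edge e)) : G.L2 :=
  WithLp.toLp 2 fun e => (G.memLp_of_continuousOn (hu e)).toLp

theorem toL2_ae_eq (u : E → ℝ → ℂ) (hu : ∀ e, ContinuousOn (u e) (G.edge e)) (e : E) :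
    G.toL2 u hu e =ᵐ[volume.restrict (G.edge e)] u e :=
  (G.memLp_of_continuousOn (hu e)).coeFn_toLp

theorem L2_ext {f g : G.L2} (h : ∀ e, f e =ᵐ[volume.restrict (G.edge e)] g e) : f = g := by
  ext e : 1
  exact Lp.ext (h e)

theorem operatorGraph_symmetric [Fintype V] (α : V → ℝ) {p p' : G.L2 × G.L2}
    (hp : p ∈ G.operatorGraph q α) (hp' : p' ∈ G.operatorGraph q α) :
    inner ℂ p.2 p'.1 = inner ℂ p.1 p'.2 := by
  obtain ⟨u, h1, h2, h3, h4, h5⟩ := hp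
  obtain ⟨w, k1, k2, k3, k4, k5⟩ := hp'
  have hl := G.lagrange_identity q α h1.conj k1 h4.conj k4
  simp only [deltaDefect_conj, h5, k5, map_zero, mul_zero, zero_mul, sub_zero,
    Finset.sum_const_zero] at hl
  rw [← sub_eq_zero, PiLp.inner_apply, PiLp.inner_apply, ← Finset.sum_sub_distrib, ← hl]
  refine Finset.sum_congr rfl fun e _ => ?_
  rw [L2.inner_def, L2.inner_def, ← integral_sub (L2.integrable_inner _ _)
    (L2.integrable_inner _ _)]
  refine integral_congr_ae ?_
  filter_upwards [h2 e, h3 e, k2 e, k3 e] with t a1 a2 a3 a4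
  rw [a1, a2, a3, a4, schrodinger_conj, RCLike.inner_apply, RCLike.inner_apply]
  simp only [conjFun]
  ring

/-- A pair `(x, μ x)` in the graph of the operator comes from a solution. -/
theorem exists_isSolution_of_mem_operatorGraph {α : V → ℝ} {μ : ℂ} {x : G.L2}
    (h : (x, μ • x) ∈ G.operatorGraph q α) : ∃ u, G.IsSolution q α μ 0 u ∧
      ∀ e, x e =ᵐ[volume.restrict (G.edge e)] u e := by
  obtain ⟨u, h1, h2, h3, h4, h5⟩ := h
  refine ⟨u, ⟨h1, fun e => ?_, h4, h5⟩, h2⟩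
  have h6 : ((μ • x : G.L2) e : ℝ → ℂ) =ᵐ[volume.restrict (G.edge e)] μ • (x e : ℝ → ℂ) :=
    Lp.coeFn_smul μ (x e)
  filter_upwards [h2 e, h3 e, h6] with t a1 a2 a3
  rw [← a2, a3, Pi.smul_apply, a1, smul_eq_mul]

theorem mem_operatorGraph_of_isSolution {α : V → ℝ} {μ : ℂ} {u : E → ℝ → ℂ}
    (h : G.IsSolution q α μ 0 u) :
    (G.toL2 u h.2.2.1.1, μ • G.toL2 u h.2.2.1.1) ∈ G.operatorGraph q α := by
  refine ⟨u, h.1, G.toL2_ae_eq u h.2.2.1.1, fun e => ?_, h.2.2.1, h.2.2.2⟩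
  have h6 : ((μ • G.toL2 u h.2.2.1.1 : G.L2) e : ℝ → ℂ) =ᵐ[volume.restrict (G.edge e)]
      μ • (G.toL2 u h.2.2.1.1 e : ℝ → ℂ) := Lp.coeFn_smul μ _
  filter_upwards [G.toL2_ae_eq u h.2.2.1.1 e, h.2.1 e, h6] with t a1 a2 a3
  rw [a2, a3, Pi.smul_apply, a1, smul_eq_mul]

variable (hq : ∀ e, IntegrableOn (q e) (Icc 0 (G.length e)))

/-- The class in `L²(G)` of the solution on the edges with given Cauchy data. -/
def solutionL2 (μ : ℂ) : (E × Bool → ℂ) →ₗ[ℂ] G.L2 where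
  toFun x := G.toL2 (G.solutionFun hq μ x) fun e => (G.continuous_solutionFun hq μ x e).continuousOn
  map_add' x y := by
    refine G.L2_ext fun e => ?_
    have hc := fun x e => (G.continuous_solutionFun hq μ x e).continuousOn (s := G.edge e)
    refine (G.toL2_ae_eq _ _ e).trans (EventuallyEq.trans ?_
      (Lp.coeFn_add (G.toL2 _ (hc x) e) (G.toL2 _ (hc y) e)).symm)
    filter_upwards [G.toL2_ae_eq _ (hc x) e, G.toL2_ae_eq _ (hc y) e] with t h1 h2
    rw [Pi.add_apply, h1, h2, solutionFun_add]; rfl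
  map_smul' c x := by
    refine G.L2_ext fun e => ?_
    have hc := fun e => (G.continuous_solutionFun hq μ x e).continuousOn (s := G.edge e)
    refine (G.toL2_ae_eq _ _ e).trans (EventuallyEq.trans ?_
      (Lp.coeFn_smul c (G.toL2 _ hc e)).symm)
    filter_upwards [G.toL2_ae_eq _ hc e] with t h1
    rw [Pi.smul_apply, h1, solutionFun_smul]; rfl

theorem solutionL2_ae_eq (μ : ℂ) (x : E × Bool → ℂ) (e : E) :
    G.solutionL2 hq μ x e =ᵐ[volume.restrict (G.edge e)] G.solutionFun hq μ x e :=
  G.toL2_ae_eq _ (fun e => (G.continuous_solutionFun hq μ x e).continuousOn) e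

theorem solutionL2_injective (μ : ℂ) : Function.Injective (G.solutionL2 hq μ) := by
  rw [← LinearMap.ker_eq_bot, LinearMap.ker_eq_bot']
  intro x hx
  refine G.eq_zero_of_solutionFun_eqOn_zero hq (μ := μ) fun e => ?_
  refine Measure.eqOn_Icc_of_ae_eq volume (G.length_pos e).ne ?_
    (G.continuous_solutionFun hq μ x e).continuousOn continuousOn_const
  refine (G.solutionL2_ae_eq hq μ x e).symm.trans ?_
  rw [hx]
  exact Lp.coeFn_zero _ _ _

theorem map_ker_characteristicMap (α : V → ℝ) (μ : ℂ) :
    (LinearMap.ker (G.characteristicMap hq α μ)).map (G.solutionL2 hq μ) =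
      (G.schrodingerOperator q α).eigenspace μ := by
  ext y
  rw [LinearPMap.mem_eigenspace_iff, graph_schrodingerOperator, Submodule.mem_map]
  constructor
  · rintro ⟨x, hx, rfl⟩
    rw [LinearMap.mem_ker, ← G.boundaryData_zero (V := V), ← isSolution_solutionFun_iff] at hx
    exact G.mem_operatorGraph_of_isSolution hx
  · intro hy
    obtain ⟨u, hu, hyu⟩ := G.exists_isSolution_of_mem_operatorGraph hy
    refine ⟨G.cauchyData u, ?_, G.L2_ext fun e => ?_⟩
    · rw [LinearMap.mem_ker, IsSolution.characteristicMap_cauchyData G hq hu, boundaryData_zero]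
    · filter_upwards [G.solutionL2_ae_eq hq μ (G.cauchyData u) e, hyu e,
        ae_restrict_mem measurableSet_Icc] with t h1 h2 ht
      rw [h1, h2]
      exact (G.eqOn_solutionFun hq hu.1 hu.2.1 e ht).symm

/-- The eigenspace is isomorphic to the kernel of the system of vertex conditions. -/
def eigenspaceEquiv (α : V → ℝ) (μ : ℂ) : LinearMap.ker (G.characteristicMap hq α μ) ≃ₗ[ℂ]
    (G.schrodingerOperator q α).eigenspace μ :=
  (Submodule.equivMapOfInjective (G.solutionL2 hq μ) (G.solutionL2_injective hq μ) _).trans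
    (LinearEquiv.ofEq _ _ (G.map_ker_characteristicMap hq α μ))

variable [DecidableEq E]

theorem exists_mem_operatorGraph (α : V → ℝ) {μ : ℂ}
    (hdet : (G.characteristicMatrix hq α μ).det ≠ 0) (g : G.L2) :
    ∃ x : G.L2, (x, μ • x + g) ∈ G.operatorGraph q α := by
  obtain ⟨y, hy1, hy2⟩ := G.exists_inhomogeneous_solution hq μ (G.integrable_L2 g)
  set x := (G.characteristicMatrix hq α μ)⁻¹.mulVec (-G.boundaryMap α y) with hx
  have hx' : G.characteristicMap hq α μ x = -G.boundaryMap α y := by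
    rw [← characteristicMatrix_mulVec, hx, Matrix.mulVec_mulVec,
      Matrix.mul_nonsing_inv _ (isUnit_iff_ne_zero.2 hdet), Matrix.one_mulVec]
  have hxs := G.isAC2_solutionFun hq μ x
  set u := y + G.solutionFun hq μ x with hu
  have huA : G.IsAC2 u := hy1.add hxs
  have hub : G.boundaryMap α u = G.boundaryData (0 : V → ℂ) := by
    rw [hu, boundaryMap_add G α hy1 hxs, ← characteristicMap_apply, hx', add_neg_cancel,
      boundaryData_zero]
  obtain ⟨huc, hud⟩ := (G.boundaryMap_eq_boundaryData_iff α huA 0).1 hub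
  refine ⟨G.toL2 u huc.1, u, huA, G.toL2_ae_eq u huc.1, fun e => ?_, huc, hud⟩
  have h5 : ((μ • G.toL2 u huc.1 + g : G.L2) e : ℝ → ℂ) =ᵐ[volume.restrict (G.edge e)]
      ((μ • G.toL2 u huc.1 : G.L2) e : ℝ → ℂ) + (g e : ℝ → ℂ) := Lp.coeFn_add _ _
  have h6 : ((μ • G.toL2 u huc.1 : G.L2) e : ℝ → ℂ) =ᵐ[volume.restrict (G.edge e)]
      μ • (G.toL2 u huc.1 e : ℝ → ℂ) := Lp.coeFn_smul μ _
  filter_upwards [G.toL2_ae_eq u huc.1 e, hy2 e, h5, h6, schrodinger_add q hy1 hxs e,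
    G.schrodinger_solutionFun hq μ x e] with t a1 a2 a3 a4 a5 a6
  rw [a3, Pi.add_apply, a4, Pi.smul_apply, a1, hu, a5]
  simp only [Pi.add_apply, a2, a6, smul_eq_mul]
  ring

/-- Off the zeros of the characteristic determinant, and of their conjugates, the resolvent
exists. -/
theorem mem_resolventSet [Fintype V] (α : V → ℝ) {μ : ℂ}
    (h : (G.characteristicMatrix hq α μ).det ≠ 0)
    (h' : (G.characteristicMatrix hq α ((starRingEnd ℂ) μ)).det ≠ 0) :
    μ ∈ (G.schrodingerOperator q α).resolventSet := by
  refine LinearPMap.mem_resolventSet_of_symmetric _ μ ?_ ?_ ?_ ?_ <;>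
    simp only [graph_schrodingerOperator]
  · exact fun p hp p' hp' => G.operatorGraph_symmetric α hp hp'
  · intro x hx
    rw [← graph_schrodingerOperator, ← LinearPMap.mem_eigenspace_iff,
      ← map_ker_characteristicMap G hq] at hx
    obtain ⟨y, hy, rfl⟩ := hx
    have : y = 0 := by
      by_contra hy0
      exact h (Matrix.exists_mulVec_eq_zero_iff.1 ⟨y, hy0, by
        rw [characteristicMatrix_mulVec]; exact hy⟩)
    rw [this, map_zero]
  · exact G.exists_mem_operatorGraph hq α h
  · exact G.exists_mem_operatorGraph hq α h'

end Operator

end MetricGraph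

/-! ### Matrix functions with simple poles -/

theorem AnalyticAt.exists_eq_sub_mul {f : ℂ → ℂ} {c : ℂ} (hf : AnalyticAt ℂ f c)
    (hc : f c = 0) : ∃ K : ℂ → ℂ, AnalyticAt ℂ K c ∧ ∀ z, f z = (z - c) * K z := by
  obtain ⟨p, hp⟩ := hf
  refine ⟨dslope f c, hp.has_fpower_series_dslope_fslope.analyticAt, fun z => ?_⟩
  rw [← smul_eq_mul, sub_smul_dslope, hc, sub_zero]

namespace MatrixFunction

variable {n : Type*} {U : Set ℂ} {M : ℂ → Matrix n n ℂ} {c : ℂ} {H : n → n → ℂ → ℂ}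

theorem isIsolated_of_simple_pole [Finite n] (hH : ∀ k l, AnalyticAt ℂ (H k l) c)
    (hM : ∀ᶠ z in 𝓝[≠] c, z ∈ U ∧ ∀ k l, M z k l = (z - c)⁻¹ * H k l z) :
    IsIsolated U M c := by
  have h1 : ∀ᶠ z in 𝓝[≠] c, ∀ k l, AnalyticAt ℂ (H k l) z :=
    nhdsWithin_le_nhds (eventually_all.2 fun k => eventually_all.2 fun l =>
      (hH k l).eventually_analyticAt)
  filter_upwards [h1, eventually_eventually_nhdsWithin.2 hM, hM, self_mem_nhdsWithin]
    with z hz1 hz2 hz3 hzc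
  refine ⟨hz3.1, fun k l => ?_⟩
  have hzc' : z ≠ c := hzc
  rw [isOpen_compl_singleton.nhdsWithin_eq hzc] at hz2
  have h2 : AnalyticAt ℂ (fun w => (w - c)⁻¹ * H k l w) z :=
    ((analyticAt_id.sub analyticAt_const).inv (sub_ne_zero.2 hzc')).mul (hz1 k l)
  exact h2.congr (hz2.mono fun w hw => (hw.2 k l).symm)

theorem hasResidue_of_simple_pole [Finite n] (hH : ∀ k l, AnalyticAt ℂ (H k l) c)
    (hM : ∀ᶠ z in 𝓝[≠] c, z ∈ U ∧ ∀ k l, M z k l = (z - c)⁻¹ * H k l z) :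
    HasResidue U M c (Matrix.of fun k l => H k l c) := by
  refine ⟨isIsolated_of_simple_pole hH hM, ?_⟩
  have h1 : ∀ᶠ z in 𝓝[≠] c, ∀ k l, AnalyticAt ℂ (H k l) z :=
    nhdsWithin_le_nhds (eventually_all.2 fun k => eventually_all.2 fun l =>
      (hH k l).eventually_analyticAt)
  obtain ⟨ε, hε, hball⟩ := Metric.mem_nhdsWithin_iff.1 (h1.and hM)
  filter_upwards [Ioo_mem_nhdsGT hε] with r hr k l
  have hr0 : r ≠ 0 := hr.1.ne'
  have e1 : (∮ z in C(c, r), M z k l) = ∮ z in C(c, r), (z - c)⁻¹ • H k l z := by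
    refine circleIntegral.integral_congr hr.1.le fun z hz => ?_
    have hz' : dist z c = r := hz
    have hzc : z ≠ c := fun h => hr0 (by rw [← hz', h, dist_self])
    exact (hball ⟨by rw [Metric.mem_ball, hz']; exact hr.2, hzc⟩).2.2 k l
  have hd : DifferentiableOn ℂ (H k l) (Metric.closedBall c r) := fun z hz => by
    by_cases hzc : z = c
    · rw [hzc]; exact (hH k l).differentiableAt.differentiableWithinAt
    · exact ((hball ⟨lt_of_le_of_lt hz hr.2, hzc⟩).1 k l).differentiableAt.differentiableWithinAt
  rw [e1, hd.circleIntegral_sub_inv_smul (Metric.mem_ball_self hr.1), smul_eq_mul, ← mul_assoc,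
    inv_mul_cancel₀ Complex.two_pi_I_ne_zero, one_mul]
  rfl

theorem isPole_iff_of_simple_pole [Finite n] (hH : ∀ k l, AnalyticAt ℂ (H k l) c)
    (hM : ∀ᶠ z in 𝓝[≠] c, z ∈ U ∧ ∀ k l, M z k l = (z - c)⁻¹ * H k l z) :
    IsPole U M c ↔ (Matrix.of fun k l => H k l c) ≠ 0 := by
  have hlim : ∀ k l, Tendsto (H k l) (𝓝[≠] c) (𝓝 (H k l c)) := fun k l =>
    (hH k l).continuousAt.tendsto.mono_left nhdsWithin_le_nhds
  constructor
  · rintro ⟨-, m, hm, L, hL0, hL⟩ h0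
    refine hL0 ?_
    ext k l
    have hHc : H k l c = 0 := congrFun (congrFun h0 k) l
    -- A vanishing residue leaves `M` bounded, so that `(z - c) ^ m • M z` tends to zero.
    obtain ⟨K, hK, hKe⟩ := (hH k l).exists_eq_sub_mul hHc
    have h1 : Tendsto (fun z => (z - c) ^ m * K z) (𝓝[≠] c) (𝓝 0) := by
      have h2 : ContinuousAt (fun z => (z - c) ^ m * K z) c :=
        ((continuousAt_id.sub continuousAt_const).pow m).mul hK.continuousAt
      have h3 := h2.tendsto.mono_left (nhdsWithin_le_nhds (s := {c}ᶜ))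
      simpa [Nat.one_le_iff_ne_zero.1 hm] using h3
    have h2 : Tendsto (fun z => ((z - c) ^ m • M z) k l) (𝓝[≠] c) (𝓝 (L k l)) :=
      ((continuous_apply_apply k l).tendsto L).comp hL
    refine tendsto_nhds_unique h2 (h1.congr' ?_)
    filter_upwards [hM, self_mem_nhdsWithin] with z hz1 hz3
    have : z - c ≠ 0 := sub_ne_zero.2 hz3
    rw [Matrix.smul_apply, hz1.2, hKe, smul_eq_mul]
    field_simp
  · intro h0
    refine ⟨isIsolated_of_simple_pole hH hM, 1, le_rfl, _, h0, ?_⟩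
    refine tendsto_pi_nhds.2 fun k => tendsto_pi_nhds.2 fun l => (hlim k l).congr' ?_
    filter_upwards [hM, self_mem_nhdsWithin] with z hz1 hz3
    have : z - c ≠ 0 := sub_ne_zero.2 hz3
    rw [Matrix.smul_apply, hz1.2, smul_eq_mul]
    field_simp

end MatrixFunction

section MatrixInverse

variable {n : Type*} [Fintype n] [DecidableEq n] {A : ℂ → Matrix n n ℂ}

theorem differentiable_det (hA : ∀ i j, Differentiable ℂ fun z => A z i j) :
    Differentiable ℂ fun z => (A z).det := by
  simp only [Matrix.det_apply]
  refine Differentiable.fun_sum fun σ _ => ?_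
  exact (Differentiable.fun_finsetProd fun i _ => hA _ _).const_smul _

theorem differentiable_adjugate (hA : ∀ i j, Differentiable ℂ fun z => A z i j) (i j : n) :
    Differentiable ℂ fun z => (A z).adjugate i j := by
  simp only [Matrix.adjugate_apply]
  refine differentiable_det fun k l => ?_
  by_cases hk : k = j
  · subst hk
    simp only [Matrix.updateRow_self]
    exact differentiable_const _
  · simp only [Matrix.updateRow_ne hk]
    exact hA k l

theorem not_eventually_det_eq_zero (hA : ∀ i j, Differentiable ℂ fun z => A z i j) {z₀ : ℂ}
    (h₀ : (A z₀).det ≠ 0) (c : ℂ) : ¬ ∀ᶠ z in 𝓝 c, (A z).det = 0 := fun h =>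
  h₀ ((AnalyticOnNhd.eqOn_zero_of_preconnected_of_eventuallyEq_zero
    (fun z _ => (differentiable_det hA).analyticAt z) isPreconnected_univ (mem_univ c) h)
    (mem_univ z₀))

theorem eventually_det_ne_zero (hA : ∀ i j, Differentiable ℂ fun z => A z i j) {z₀ : ℂ}
    (h₀ : (A z₀).det ≠ 0) (c : ℂ) : ∀ᶠ z in 𝓝[≠] c, (A z).det ≠ 0 :=
  ((differentiable_det hA).analyticAt c).eventually_eq_zero_or_eventually_ne_zero.resolve_left
    (not_eventually_det_eq_zero hA h₀ c)

/-- The inverse of an entire matrix function is meromorphic. -/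
theorem exists_pow_smul_inv_mulVec (hA : ∀ i j, Differentiable ℂ fun z => A z i j) {z₀ : ℂ}
    (h₀ : (A z₀).det ≠ 0) (c : ℂ) (b : n → ℂ) : ∃ (m : ℕ) (h : ℂ → n → ℂ),
      (∀ i, AnalyticAt ℂ (fun z => h z i) c) ∧
      ∀ᶠ z in 𝓝[≠] c, (z - c) ^ m • (A z)⁻¹.mulVec b = h z := by
  obtain ⟨m, g, hg, hg0, hge⟩ := ((differentiable_det hA).analyticAt
    c).exists_eventuallyEq_pow_smul_nonzero_iff.2 (not_eventually_det_eq_zero hA h₀ c)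
  refine ⟨m, fun z => (g z)⁻¹ • (A z).adjugate.mulVec b, fun i => ?_, ?_⟩
  · refine (hg.inv hg0).mul ?_
    have : Differentiable ℂ fun z => (A z).adjugate.mulVec b i := by
      simp only [Matrix.mulVec, dotProduct]
      exact Differentiable.fun_sum fun j _ => (differentiable_adjugate hA i j).mul_const _
    exact this.analyticAt c
  · filter_upwards [hge.filter_mono nhdsWithin_le_nhds,
      (hg.continuousAt.eventually_ne hg0).filter_mono nhdsWithin_le_nhds, self_mem_nhdsWithin]
      with z h1 h2 h3
    have h4 : (z - c) ^ m ≠ 0 := pow_ne_zero _ (sub_ne_zero.2 h3)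
    rw [Matrix.inv_def, Ring.inverse_eq_inv', h1, Matrix.smul_mulVec, smul_smul, smul_eq_mul]
    congr 1
    field_simp

end MatrixInverse

namespace MetricGraph

/-! ### The singularity of the Titchmarsh--Weyl function -/

section Residue

variable {V E : Type*} [Fintype E] (G : MetricGraph V E) {q : E → ℝ → ℝ}
  (hq : ∀ e, IntegrableOn (q e) (Icc 0 (G.length e)))

/-- The bilinear pairing `∫ u w` over the graph. -/
def pairing (u w : E → ℝ → ℂ) : ℂ := ∑ e, ∫ t in G.edge e, u e t * w e t

theorem pairing_solutionFun (z : ℂ) (x : E × Bool → ℂ) {w : E → ℝ → ℂ}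
    (hw : ∀ e, ContinuousOn (w e) (G.edge e)) :
    G.pairing (G.solutionFun hq z x) w = ∑ e, volterra (G.length_pos e).le (w e)
      (hw e).integrableOn_Icc (G.edgeSolution hq z e x)
        ⟨G.length e, right_mem_Icc.2 (G.length_pos e).le⟩ := by
  refine Finset.sum_congr rfl fun e _ => ?_
  rw [volterra_apply, intervalIntegral.integral_of_le (G.length_pos e).le,
    ← integral_Icc_eq_integral_Ioc]
  exact integral_congr_ae (ae_of_all _ fun t => mul_comm _ _)

theorem continuousAt_pairing_solutionFun {h : ℂ → E × Bool → ℂ} {c : ℂ} (hh : ContinuousAt h c)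
    {w : E → ℝ → ℂ} (hw : ∀ e, ContinuousOn (w e) (G.edge e)) :
    ContinuousAt (fun z => G.pairing (G.solutionFun hq z (h z)) w) c := by
  simp only [pairing_solutionFun G hq _ _ hw]
  refine tendsto_finsetSum _ fun e _ => ?_
  have hhp : ∀ p, ContinuousAt (fun z => h z p) c := fun p =>
    (continuous_apply p).continuousAt.comp hh
  have h2 : ContinuousAt (fun z => G.edgeSolution hq z e (h z)) c :=
    ((differentiable_solutionOp (G.length_pos e).le (hq e)).continuous.continuousAt).clm_apply
      (((hhp _).smul continuousAt_const).add ((hhp _).smul continuousAt_const))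
  exact ((ContinuousMap.evalCLM ℂ
    (⟨G.length e, right_mem_Icc.2 (G.length_pos e).le⟩ : G.edge e)).continuous.comp
      (volterra (G.length_pos e).le (w e) (hw e).integrableOn_Icc).continuous).continuousAt.comp h2

theorem IsSolution.congr {α : V → ℝ} {μ : ℂ} {h : V → ℂ} {u w : E → ℝ → ℂ}
    (hu : G.IsSolution q α μ h u) (huw : ∀ e, EqOn (u e) (w e) (G.edge e)) :
    G.IsSolution q α μ h w := by
  have hw := IsAC2.congr G hu.1 huw
  refine ⟨hw, fun e => ?_, ?_⟩
  · filter_upwards [hu.2.1 e, ae_restrict_mem measurableSet_Icc] with t h1 ht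
    rw [← G.schrodinger_congr q huw e ht, h1, huw e ht]
  · rw [← G.boundaryMap_eq_boundaryData_iff α hw, ← G.boundaryMap_congr α huw,
      G.boundaryMap_eq_boundaryData_iff α hu.1]
    exact hu.2.2

theorem solutionFun_eq_sum [DecidableEq E] (z : ℂ) (x : E × Bool → ℂ) (e : E) (t : ℝ) :
    G.solutionFun hq z x e t = ∑ p, x p * G.solutionFun hq z (Pi.single p 1) e t := by
  have h : x = ∑ p, x p • (Pi.single p 1 : E × Bool → ℂ) := by
    funext i
    simp [Finset.sum_apply, Pi.single_apply]
  have h2 : ∀ y : E × Bool → ℂ, G.solutionFun hq z y e t =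
      G.edgeSolution hq z e y (projIcc 0 (G.length e) (G.length_pos e).le t) := fun y => rfl
  simp only [h2]
  conv_lhs => rw [h, map_sum]
  rw [ContinuousMap.sum_apply]
  refine Finset.sum_congr rfl fun p _ => ?_
  rw [map_smul, ContinuousMap.smul_apply, smul_eq_mul]

theorem analyticAt_vertexValue_solutionFun {h : ℂ → E × Bool → ℂ} {c : ℂ}
    (hh : ∀ p, AnalyticAt ℂ (fun z => h z p) c) (v : V) :
    AnalyticAt ℂ (fun z => G.vertexValue (G.solutionFun hq z (h z)) v) c := by
  classical
  simp only [vertexValue_eq]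
  have : ∀ z, G.solutionFun hq z (h z) (G.rep v).1 (G.endCoord (G.rep v)) =
      ∑ p, h z p * G.solutionFun hq z (Pi.single p 1) (G.rep v).1 (G.endCoord (G.rep v)) :=
    fun z => G.solutionFun_eq_sum hq z _ _ _
  simp only [this]
  refine Finset.analyticAt_fun_sum _ fun p _ => (hh p).mul ?_
  exact (G.differentiable_solutionFun hq (Pi.single p 1) (G.endCoord_mem _)).analyticAt c

variable [DecidableEq E]

/-- The Cauchy data of the solution with data `h` in the `δ`-conditions, off the zeros of the
characteristic determinant. -/
def dataSolution (α : V → ℝ) (h : V → ℂ) (z : ℂ) : E × Bool → ℂ :=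
  (G.characteristicMatrix hq α z)⁻¹.mulVec (G.boundaryData h)

theorem characteristicMap_dataSolution (α : V → ℝ) (h : V → ℂ) {z : ℂ}
    (hz : (G.characteristicMatrix hq α z).det ≠ 0) :
    G.characteristicMap hq α z (G.dataSolution hq α h z) = G.boundaryData h := by
  rw [← characteristicMatrix_mulVec, dataSolution, Matrix.mulVec_mulVec,
    Matrix.mul_nonsing_inv _ (isUnit_iff_ne_zero.2 hz), Matrix.one_mulVec]

theorem isSolution_dataSolution (α : V → ℝ) (h : V → ℂ) {z : ℂ}
    (hz : (G.characteristicMatrix hq α z).det ≠ 0) :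
    G.IsSolution q α z h (G.solutionFun hq z (G.dataSolution hq α h z)) :=
  (G.isSolution_solutionFun_iff hq α z h _).2 (G.characteristicMap_dataSolution hq α h hz)

theorem IsSolution.cauchyData_eq {α : V → ℝ} {h : V → ℂ} {z : ℂ}
    (hz : (G.characteristicMatrix hq α z).det ≠ 0) {u : E → ℝ → ℂ}
    (hu : G.IsSolution q α z h u) : G.cauchyData u = G.dataSolution hq α h z := by
  rw [dataSolution, ← IsSolution.characteristicMap_cauchyData G hq hu,
    ← characteristicMatrix_mulVec, Matrix.mulVec_mulVec,
    Matrix.nonsing_inv_mul _ (isUnit_iff_ne_zero.2 hz), Matrix.one_mulVec]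

open Classical in
theorem titchmarshWeyl_apply (α : V → ℝ) (B : Finset V) {z : ℂ}
    (hz : (G.characteristicMatrix hq α z).det ≠ 0) (k l : B) :
    G.titchmarshWeyl q α B z k l = G.vertexValue (G.solutionFun hq z
      (G.dataSolution hq α (fun v => if v = l then 1 else 0) z)) k := by
  have H : ∃ u, G.IsSolution q α z (fun v => if v = l then 1 else 0) u :=
    ⟨_, G.isSolution_dataSolution hq α _ hz⟩
  rw [titchmarshWeyl, dif_pos H, ← IsSolution.cauchyData_eq G hq hz H.choose_spec]
  exact G.vertexValue_congr (G.eqOn_solutionFun hq H.choose_spec.1 H.choose_spec.2.1) _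

theorem tendsto_characteristicMap {h : ℂ → E × Bool → ℂ} {c : ℂ} (α : V → ℝ)
    (hh : ContinuousAt h c) :
    Tendsto (fun z => G.characteristicMap hq α z (h z)) (𝓝 c)
      (𝓝 (G.characteristicMap hq α c (h c))) := by
  simp only [← characteristicMatrix_mulVec]
  refine tendsto_pi_nhds.2 fun i => tendsto_finsetSum _ fun j _ => ?_
  exact ((G.differentiable_characteristicMatrix hq α i j).continuous.tendsto c).mul
    (((continuous_apply j).continuousAt.comp hh))

variable [Fintype V]

/-- The leading coefficient of the Laurent expansion of the solution with data `k` in the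
`δ`-conditions: it solves the homogeneous problem, and its pairing with the solutions of the
homogeneous problem is determined by Lagrange's identity. -/
theorem leadingCoefficient_spec {α : V → ℝ} {c : ℂ} {k : V → ℂ} {m : ℕ} {h : ℂ → E × Bool → ℂ}
    (hh : ContinuousAt h c)
    (hdet : ∀ᶠ z in 𝓝[≠] c, (G.characteristicMatrix hq α z).det ≠ 0)
    (hm : ∀ᶠ z in 𝓝[≠] c, (z - c) ^ (m + 1) • G.dataSolution hq α k z = h z) :
    G.characteristicMap hq α c (h c) = 0 ∧ ∀ w, G.IsSolution q α c 0 w →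
      G.pairing (G.solutionFun hq c (h c)) w = -(0 ^ m * ∑ v, k v * G.vertexValue w v) := by
  have hpow : ∀ j : ℕ, Tendsto (fun z : ℂ => (z - c) ^ j) (𝓝[≠] c) (𝓝 (0 ^ j)) := fun j => by
    have : ContinuousAt (fun z : ℂ => (z - c) ^ j) c :=
      (continuousAt_id.sub continuousAt_const).pow j
    simpa using this.tendsto.mono_left (nhdsWithin_le_nhds (s := {c}ᶜ))
  constructor
  · refine tendsto_nhds_unique
      ((G.tendsto_characteristicMap hq α hh).mono_left (nhdsWithin_le_nhds (s := {c}ᶜ))) ?_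
    have h1 := (hpow (m + 1)).smul_const (G.boundaryData k)
    rw [zero_pow (Nat.succ_ne_zero m), zero_smul] at h1
    refine h1.congr' ?_
    filter_upwards [hdet, hm] with z hz1 hz2
    rw [← hz2, map_smul, G.characteristicMap_dataSolution hq α k hz1]
  · intro w hw
    refine tendsto_nhds_unique ((G.continuousAt_pairing_solutionFun hq hh
      hw.2.2.1.1).tendsto.mono_left (nhdsWithin_le_nhds (s := {c}ᶜ))) ?_
    have h1 := ((hpow m).mul_const (∑ v, k v * G.vertexValue w v)).neg
    refine h1.congr' ?_
    filter_upwards [hdet, hm, self_mem_nhdsWithin] with z hz1 hz2 hz3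
    have hzc : z - c ≠ 0 := sub_ne_zero.2 hz3
    have h2 := IsSolution.lagrange G (G.isSolution_dataSolution hq α k hz1) hw
    simp only [Pi.zero_apply, mul_zero, zero_sub, Finset.sum_neg_distrib] at h2
    have h3 : G.pairing (G.solutionFun hq z (h z)) w = (z - c) ^ (m + 1) *
        ∑ e, ∫ t in G.edge e, G.solutionFun hq z (G.dataSolution hq α k z) e t * w e t := by
      rw [← hz2, solutionFun_smul, pairing, Finset.mul_sum]
      refine Finset.sum_congr rfl fun e _ => ?_
      rw [← integral_const_mul]
      exact integral_congr_ae (ae_of_all _ fun t => mul_assoc _ _ _)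
    rw [h3]
    linear_combination -(z - c) ^ m * h2

/-- The solutions with given data in the `δ`-conditions have at most simple poles at real points:
if the order of the pole is at least two, then the leading coefficient is orthogonal to itself. -/
theorem exists_simple_pole (α : V → ℝ) (lam : ℝ) (k : V → ℂ) : ∃ h : ℂ → E × Bool → ℂ,
    (∀ p, AnalyticAt ℂ (fun z => h z p) lam) ∧
    ∀ᶠ z : ℂ in 𝓝[≠] (lam : ℂ), (z - lam) • G.dataSolution hq α k z = h z := by
  have hdet₀ : (G.characteristicMatrix hq α Complex.I).det ≠ 0 :=
    G.det_characteristicMatrix_ne_zero hq α (by simp)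
  have hdiff := G.differentiable_characteristicMatrix hq α
  have hdet := eventually_det_ne_zero hdiff hdet₀ (lam : ℂ)
  obtain ⟨m, h, hh, hm⟩ := exists_pow_smul_inv_mulVec hdiff hdet₀ (lam : ℂ) (G.boundaryData k)
  induction m generalizing h with
  | zero =>
    refine ⟨fun z => (z - lam) • h z, fun p =>
      (analyticAt_id.sub analyticAt_const).mul (hh p), hm.mono fun z hz => ?_⟩
    rw [pow_zero, one_smul] at hz
    simp only [← hz]
    rfl
  | succ m ih =>
    rcases Nat.eq_zero_or_pos m with rfl | hm0
    · exact ⟨h, hh, hm.mono fun z hz => by rw [← hz, zero_add, pow_one]; rfl⟩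
    have hc : ContinuousAt h (lam : ℂ) := continuousAt_pi.2 fun p => (hh p).continuousAt
    obtain ⟨h1, h2⟩ := G.leadingCoefficient_spec hq hc hdet hm
    rw [← G.boundaryData_zero (V := V), ← isSolution_solutionFun_iff] at h1
    -- `lam` is real, so the conjugate of the leading coefficient is a solution too
    have h3 := IsSolution.conj G h1
    simp only [Pi.zero_apply, map_zero, Complex.conj_ofReal] at h3
    have h4 := h2 _ h3
    rw [zero_pow hm0.ne', zero_mul, neg_zero] at h4
    have h5 : h lam = 0 := G.eq_zero_of_solutionFun_eqOn_zero hq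
      (G.eqOn_zero_of_integral_mul_conj h1.2.2.1.1 h4)
    choose K hK hKe using fun p => (hh p).exists_eq_sub_mul (congrFun h5 p)
    refine ih (fun z p => K p z) hK ?_
    filter_upwards [hm, self_mem_nhdsWithin] with z hz1 hz2
    have hzc : z - lam ≠ 0 := sub_ne_zero.2 hz2
    funext p
    have h6 := congrFun hz1 p
    rw [hKe p z, Pi.smul_apply, smul_eq_mul, pow_succ'] at h6
    rw [Pi.smul_apply, smul_eq_mul]
    exact mul_left_cancel₀ hzc (by rw [← h6, mul_assoc])

end Residue

end MetricGraph

/-- If `R = T ∘ ρ`, where `ρ` is a negative adjoint of `T` in the sense of the two hypotheses, then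
`R` and `T` have the same rank. -/
theorem Matrix.rank_eq_finrank_range_of_adjoint {n K : Type*} [Fintype n] [AddCommGroup K]
    [Module ℂ K] [FiniteDimensional ℂ K] (R : Matrix n n ℂ) (T : K →ₗ[ℂ] (n → ℂ)) (ρ : n → K)
    (hR : ∀ k l, R k l = T (ρ l) k)
    (h1 : ∀ c : n → ℂ, T (∑ l, c l • ρ l) = 0 → ∑ l, c l • ρ l = 0)
    (h2 : ∀ c : n → ℂ, ∑ l, c l • ρ l = 0 ↔ ∀ φ, ∑ l, c l * T φ l = 0) :
    R.rank = Module.finrank ℂ (LinearMap.range T) := by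
  classical
  have hR' : ∀ c, R.mulVecLin c = T (∑ l, c l • ρ l) := fun c => by
    funext k
    simp only [Matrix.mulVecLin_apply, Matrix.mulVec, dotProduct, hR, map_sum, map_smul,
      Finset.sum_apply, Pi.smul_apply, smul_eq_mul]
    exact Finset.sum_congr rfl fun l _ => mul_comm _ _
  let Q : (n → ℂ) →ₗ[ℂ] Module.Dual ℂ K :=
    T.dualMap ∘ₗ (Module.piEquiv n ℂ ℂ : (n → ℂ) ≃ₗ[ℂ] Module.Dual ℂ (n → ℂ)).toLinearMap
  have hQ : ∀ c φ, Q c φ = ∑ l, c l * T φ l := fun c φ => by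
    simp [Q, Module.piEquiv_apply_apply, mul_comm]
  have hker : LinearMap.ker R.mulVecLin = LinearMap.ker Q := by
    ext c
    rw [LinearMap.mem_ker, LinearMap.mem_ker, hR', LinearMap.ext_iff]
    simp only [hQ, LinearMap.zero_apply]
    rw [← h2]
    exact ⟨h1 c, fun h => by rw [h, map_zero]⟩
  have e1 := LinearMap.finrank_range_add_finrank_ker R.mulVecLin
  have e2 := LinearMap.finrank_range_add_finrank_ker Q
  have e3 : LinearMap.range Q = LinearMap.range T.dualMap :=
    LinearMap.range_comp_of_range_eq_top _ (LinearEquiv.range _)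
  rw [hker] at e1
  rw [e3, LinearMap.finrank_range_dualMap_eq_finrank_range] at e2
  rw [Matrix.rank]
  omega

namespace MetricGraph

section Rank

variable {V E : Type*} [Fintype E] (G : MetricGraph V E) {q : E → ℝ → ℝ}
  (hq : ∀ e, IntegrableOn (q e) (Icc 0 (G.length e)))

theorem pairing_solutionFun_sum {ι : Type*} (s : Finset ι) (z : ℂ) (c : ι → ℂ)
    (x : ι → E × Bool → ℂ) {w : E → ℝ → ℂ} (hw : ∀ e, ContinuousOn (w e) (G.edge e)) :
    G.pairing (G.solutionFun hq z (∑ l ∈ s, c l • x l)) w =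
      ∑ l ∈ s, c l * G.pairing (G.solutionFun hq z (x l)) w := by
  simp only [pairing_solutionFun G hq _ _ hw, map_sum, map_smul, ContinuousMap.sum_apply,
    ContinuousMap.smul_apply, smul_eq_mul, Finset.mul_sum]
  exact Finset.sum_comm

/-- The value at a vertex of the solution on the edges with given Cauchy data. -/
def vertexValueLin (z : ℂ) (v : V) : (E × Bool → ℂ) →ₗ[ℂ] ℂ where
  toFun x := G.vertexValue (G.solutionFun hq z x) v
  map_add' x y := by rw [solutionFun_add]; rfl
  map_smul' c x := by rw [solutionFun_smul]; rfl

/-- The restriction of the solutions of the homogeneous problem to a set of vertices. -/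
def restrictionMap (α : V → ℝ) (B : Finset V) (z : ℂ) :
    LinearMap.ker (G.characteristicMap hq α z) →ₗ[ℂ] (B → ℂ) :=
  (LinearMap.pi fun b : B => G.vertexValueLin hq z b) ∘ₗ Submodule.subtype _

theorem restrictionMap_apply (α : V → ℝ) (B : Finset V) (z : ℂ)
    (x : LinearMap.ker (G.characteristicMap hq α z)) (b : B) :
    G.restrictionMap hq α B z x b = G.vertexValue (G.solutionFun hq z x) b := rfl

theorem mem_ker_characteristicMap_iff (α : V → ℝ) (z : ℂ) (x : E × Bool → ℂ) :
    x ∈ LinearMap.ker (G.characteristicMap hq α z) ↔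
      G.IsSolution q α z 0 (G.solutionFun hq z x) := by
  rw [LinearMap.mem_ker, ← G.boundaryData_zero (V := V), ← isSolution_solutionFun_iff]

variable [Fintype V] [DecidableEq E]

/-- Near a real point the Titchmarsh--Weyl function has at most a simple pole, and its residue has
the rank of the restriction to `B` of the eigenfunctions. -/
theorem exists_residue (α : V → ℝ) (B : Finset V) (lam : ℝ) :
    ∃ R : Matrix B B ℂ,
      MatrixFunction.HasResidue (G.schrodingerOperator q α).resolventSet
        (G.titchmarshWeyl q α B) lam R ∧
      (MatrixFunction.IsPole (G.schrodingerOperator q α).resolventSet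
        (G.titchmarshWeyl q α B) lam ↔ R ≠ 0) ∧
      R.rank = Module.finrank ℂ (LinearMap.range (G.restrictionMap hq α B lam)) := by
  classical
  have hdet₀ : (G.characteristicMatrix hq α Complex.I).det ≠ 0 :=
    G.det_characteristicMatrix_ne_zero hq α (by simp)
  have hdet := eventually_det_ne_zero (G.differentiable_characteristicMatrix hq α) hdet₀ (lam : ℂ)
  -- near `lam` the determinant is nonzero at the conjugate of `z` as well
  have hconj : Tendsto (starRingEnd ℂ) (𝓝[≠] (lam : ℂ)) (𝓝[≠] (lam : ℂ)) := by
    refine tendsto_nhdsWithin_iff.2 ⟨?_, ?_⟩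
    · have := Complex.continuous_conj.tendsto (lam : ℂ)
      rw [Complex.conj_ofReal] at this
      exact this.mono_left nhdsWithin_le_nhds
    · filter_upwards [self_mem_nhdsWithin] with z hz h
      refine hz ?_
      have := congrArg (starRingEnd ℂ) (mem_singleton_iff.1 h)
      rwa [Complex.conj_conj, Complex.conj_ofReal] at this
  choose h hh hs using fun l : B =>
    G.exists_simple_pole hq α lam (fun v => if v = l then 1 else 0)
  have hlead := fun l : B => G.leadingCoefficient_spec hq (m := 0)
    (continuousAt_pi.2 fun p => (hh l p).continuousAt) hdet
    ((hs l).mono fun z hz => by rw [zero_add, pow_one]; exact hz)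
  have hH : ∀ k l : B, AnalyticAt ℂ
      (fun z => G.vertexValue (G.solutionFun hq z (h l z)) k) lam := fun k l =>
    G.analyticAt_vertexValue_solutionFun hq (hh l) k
  have hM : ∀ᶠ z in 𝓝[≠] (lam : ℂ), z ∈ (G.schrodingerOperator q α).resolventSet ∧
      ∀ k l, G.titchmarshWeyl q α B z k l =
        (z - lam)⁻¹ * G.vertexValue (G.solutionFun hq z (h l z)) k := by
    filter_upwards [hdet, hconj.eventually hdet, eventually_all.2 hs, self_mem_nhdsWithin]
      with z hz1 hz2 hz3 hz4
    refine ⟨G.mem_resolventSet hq α hz1 hz2, fun k l => ?_⟩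
    have hzc : z - lam ≠ 0 := sub_ne_zero.2 hz4
    rw [G.titchmarshWeyl_apply hq α B hz1, ← hz3 l]
    change G.vertexValueLin hq z k _ = _ * G.vertexValueLin hq z k _
    rw [map_smul, smul_eq_mul, inv_mul_cancel_left₀ hzc]
  refine ⟨_, MatrixFunction.hasResidue_of_simple_pole hH hM,
    MatrixFunction.isPole_iff_of_simple_pole hH hM, ?_⟩
  -- the residues at `lam` of the solutions with data `δ_l`
  let ρ : B → LinearMap.ker (G.characteristicMap hq α lam) := fun l =>
    ⟨h l lam, LinearMap.mem_ker.2 (hlead l).1⟩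
  have hpair : ∀ (c : B → ℂ) (w : E → ℝ → ℂ), G.IsSolution q α lam 0 w →
      G.pairing (G.solutionFun hq lam (∑ l, c l • ρ l : LinearMap.ker _)) w =
        -∑ l, c l * G.vertexValue w l := fun c w hw => by
    rw [Submodule.coe_sum]
    simp only [Submodule.coe_smul]
    rw [G.pairing_solutionFun_sum hq _ _ _ _ hw.2.2.1.1, ← Finset.sum_neg_distrib]
    refine Finset.sum_congr rfl fun l _ => ?_
    rw [(hlead l).2 w hw]
    simp
  -- a combination of the residues that is orthogonal to its own conjugate is zero
  have hzero : ∀ c : B → ℂ, (∑ l, c l * (starRingEnd ℂ) (G.vertexValue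
      (G.solutionFun hq lam (∑ l, c l • ρ l : LinearMap.ker _)) l) = 0) → ∑ l, c l • ρ l = 0 := by
    intro c hc
    set r := ∑ l, c l • ρ l with hr
    have hsol := (G.mem_ker_characteristicMap_iff hq α lam r).1 r.2
    have hcon := IsSolution.conj G hsol
    simp only [Pi.zero_apply, map_zero, Complex.conj_ofReal] at hcon
    have h0 := hpair c _ hcon
    simp only [vertexValue_conj, ← hr, hc, neg_zero] at h0
    exact Subtype.ext (G.eq_zero_of_solutionFun_eqOn_zero hq
      (G.eqOn_zero_of_integral_mul_conj hsol.2.2.1.1 h0))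
  refine Matrix.rank_eq_finrank_range_of_adjoint _ (G.restrictionMap hq α B lam) ρ
    (fun k l => rfl) (fun c hc => hzero c ?_) fun c => ⟨fun hc φ => ?_, fun hc => hzero c ?_⟩
  · refine Finset.sum_eq_zero fun l _ => ?_
    have := congrFun hc l
    rw [restrictionMap_apply] at this
    rw [this, Pi.zero_apply, map_zero, mul_zero]
  · have h0 := hpair c _ ((G.mem_ker_characteristicMap_iff hq α lam φ).1 φ.2)
    have h1 : G.pairing (G.solutionFun hq lam ((0 : LinearMap.ker (G.characteristicMap hq α lam)) :
        E × Bool → ℂ)) (G.solutionFun hq lam φ) = 0 := by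
      have := G.pairing_solutionFun_sum hq (∅ : Finset B) lam c (fun _ => 0)
        (w := G.solutionFun hq lam φ) fun e => (G.continuous_solutionFun hq _ _ e).continuousOn
      simpa using this
    rw [hc, h1] at h0
    simp only [restrictionMap_apply]
    exact neg_eq_zero.1 h0.symm
  · set r := ∑ l, c l • ρ l with hr
    have hcon := IsSolution.conj G ((G.mem_ker_characteristicMap_iff hq α lam r).1 r.2)
    simp only [Pi.zero_apply, map_zero, Complex.conj_ofReal] at hcon
    have heq := G.eqOn_solutionFun hq hcon.1 hcon.2.1
    have hmem := (G.mem_ker_characteristicMap_iff hq α lam _).2 (IsSolution.congr G hcon heq)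
    have h0 := hc ⟨_, hmem⟩
    simp only [restrictionMap_apply, ← G.vertexValue_congr heq, vertexValue_conj] at h0
    exact h0

end Rank

/-! ### Eigenfunctions vanishing on a set of vertices: propagation of zeros -/

section Joins

variable {V E : Type*} (G : MetricGraph V E)

/-- The edge `e` joins the vertices `v` and `w`. -/
def Joins (e : E) (v w : V) : Prop :=
  G.init e = v ∧ G.term e = w ∨ G.init e = w ∧ G.term e = v

variable {G}

theorem Joins.symm {e : E} {v w : V} (h : G.Joins e v w) : G.Joins e w v := Or.symm h

theorem joins_endVertex (p : E × Bool) : G.Joins p.1 (G.endVertex p) (G.endVertex (p.1, !p.2)) := by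
  rcases p with ⟨e, _ | _⟩
  · exact Or.inl ⟨rfl, rfl⟩
  · exact Or.inr ⟨rfl, rfl⟩

theorem Joins.eq_or_eq {e : E} {v w v' w' : V} (h : G.Joins e v w) (h' : G.Joins e v' w') :
    v = v' ∧ w = w' ∨ v = w' ∧ w = v' := by
  rcases h with ⟨rfl, rfl⟩ | ⟨rfl, rfl⟩ <;> rcases h' with ⟨rfl, rfl⟩ | ⟨rfl, rfl⟩ <;> simp

variable (G)

/-- The endpoint of the edge `e` at its earlier vertex in the order given by `τ` (the endpoint `0`
if `e` is a loop). -/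
def earlyEnd (τ : V → ℕ) (e : E) : E × Bool := (e, decide (τ (G.term e) < τ (G.init e)))

theorem earlyEnd_eq {τ : V → ℕ} {p : E × Bool}
    (h : τ (G.endVertex p) < τ (G.endVertex (p.1, !p.2))) : G.earlyEnd τ p.1 = p := by
  rcases p with ⟨e, _ | _⟩
  · have h' : τ (G.init e) < τ (G.term e) := h
    simp [earlyEnd, h'.le]
  · have h' : τ (G.term e) < τ (G.init e) := h
    simp [earlyEnd, h']

/-- The derivative at an endpoint of an edge, in the direction of the edge. -/
def endDeriv (u : E → ℝ → ℂ) (p : E × Bool) : ℂ := G.D p.1 (u p.1) (G.endCoord p)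

theorem normalDeriv_eq_sum [Fintype E] [DecidableEq V] (u : E → ℝ → ℂ) (v : V) :
    G.normalDeriv u v = ∑ p : E × Bool,
      if G.endVertex p = v then (bif p.2 then 1 else -1) * G.endDeriv u p else 0 := by
  rw [Fintype.sum_prod_type]
  simp only [Fintype.sum_bool, Finset.sum_add_distrib, normalDeriv, endDeriv, endVertex, endCoord,
    cond_true, cond_false, one_mul, neg_mul]
  rw [sub_eq_add_neg, ← Finset.sum_neg_distrib]
  congr 1
  · exact Finset.sum_congr rfl fun e _ => by congr
  · refine Finset.sum_congr rfl fun e _ => ?_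
    split_ifs <;> simp

end Joins

section Propagation

variable {V E : Type*} (G : MetricGraph V E) {q : E → ℝ → ℝ} {u : E → ℝ → ℂ} {μ : ℂ}

/-- A solution of `-u'' + q u = μ u` with zero Cauchy data at an endpoint of an edge vanishes on
the edge. -/
theorem eqOn_zero_of_endpoint (hq : ∀ e, IntegrableOn (q e) (Icc 0 (G.length e)))
    (hu : G.IsAC2 u)
    (h : ∀ e, ∀ᵐ t ∂volume.restrict (G.edge e), G.schrodinger q u e t = μ * u e t)
    (p : E × Bool) (h0 : u p.1 (G.endCoord p) = 0) (h1 : G.endDeriv u p = 0) :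
    EqOn (u p.1) 0 (G.edge p.1) := by
  -- By the constancy of the Wronskian it suffices to consider the endpoint `0`.
  have key : u p.1 0 = 0 ∧ G.D p.1 (u p.1) 0 = 0 := by
    rcases p with ⟨e, _ | _⟩
    · exact ⟨h0, h1⟩
    · have hw : ∀ x : E × Bool → ℂ, u e 0 * x (e, true) - G.D e (u e) 0 * x (e, false) = 0 := by
        intro x
        have hl := G.integral_edge_lagrange q hu (G.isAC2_solutionFun hq μ x) e
        have hz : ∫ t in G.edge e, (G.schrodinger q u e t * G.solutionFun hq μ x e t -
            u e t * G.schrodinger q (G.solutionFun hq μ x) e t) = 0 := by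
          rw [integral_eq_zero_of_ae]
          filter_upwards [h e, G.schrodinger_solutionFun hq μ x e] with t a1 a2
          rw [a1, a2, Pi.zero_apply]; ring
        have h0' : u e (G.length e) = 0 := h0
        have h1' : G.D e (u e) (G.length e) = 0 := h1
        rw [hz, h0', h1', D_solutionFun_zero, solutionFun_zero] at hl
        linear_combination hl
      -- the Wronskians with the two fundamental solutions
      have w1 := hw fun p => bif p.2 then 1 else 0
      have w2 := hw fun p => bif p.2 then 0 else 1
      simp at w1 w2
      exact ⟨w1, w2⟩
  intro t ht
  rw [G.eqOn_solutionFun hq hu h p.1 ht, solutionFun_of_mem G hq _ _ ht]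
  have h2 : G.cauchyData u (p.1, false) = 0 := key.1
  have h3 : G.cauchyData u (p.1, true) = 0 := key.2
  have h4 : G.edgeSolution hq μ p.1 (G.cauchyData u) =
      solutionOp (G.length_pos p.1).le (hq p.1) μ (G.cauchyData u (p.1, false) • 1 +
        G.cauchyData u (p.1, true) • coordMap (G.length p.1)) := rfl
  have h5 : (0 : ℂ) • (1 : C(G.edge p.1, ℂ)) + (0 : ℂ) • coordMap (G.length p.1) = 0 := by
    ext; simp
  rw [h4, h2, h3, h5, map_zero]
  rfl

theorem endDeriv_eq_zero (p : E × Bool) (h : EqOn (u p.1) 0 (G.edge p.1)) :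
    G.endDeriv u p = 0 := by
  have hD : G.D p.1 (0 : ℝ → ℂ) = 0 := by simpa using D_smul (G := G) (e := p.1) 0 0
  rw [endDeriv, D_congr h (G.endCoord_mem p), hD, Pi.zero_apply]

/-- **Propagation of zeros.** The vertices are processed in the order given by `τ`. When `v` is
processed, `u v = 0`, because `v ∈ B` or because `u` vanishes on an edge to an earlier vertex; then
`u` vanishes on all edges at `v` at whose early end the derivative vanishes, and the vertex
condition takes care of the one edge in `O` that leaves `v`, if there is one. -/
theorem IsSolution.eqOn_zero_of_endDeriv [Fintype E]
    (hq : ∀ e, IntegrableOn (q e) (Icc 0 (G.length e))) {α : V → ℝ}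
    (hu : G.IsSolution q α μ 0 u) {B : Finset V} (hB : ∀ b ∈ B, G.vertexValue u b = 0)
    (τ : V → ℕ) (hτ : Function.Injective τ)
    (hearlier : ∀ v, v ∉ B → ∃ e w, G.Joins e v w ∧ τ w < τ v) (O : Finset E)
    (hO : ∀ e ∈ O, G.init e ≠ G.term e)
    (hO' : ∀ e ∈ O, ∀ e' ∈ O, G.endVertex (G.earlyEnd τ e) = G.endVertex (G.earlyEnd τ e') →
      e = e')
    (hd : ∀ e, e ∉ O → G.endDeriv u (G.earlyEnd τ e) = 0) (e : E) :
    EqOn (u e) 0 (G.edge e) := by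
  classical
  suffices H : ∀ n v, τ v = n → ∀ p, G.endVertex p = v → EqOn (u p.1) 0 (G.edge p.1) from
    H _ _ rfl (e, false) rfl
  intro n
  induction n using Nat.strong_induction_on with
  | _ n ih =>
  intro v hv
  have hval : ∀ p, u p.1 (G.endCoord p) = G.vertexValue u (G.endVertex p) := fun p =>
    (G.vertexValue_endVertex hu.2.2.1 p).symm
  have hv0 : G.vertexValue u v = 0 := by
    by_cases hvB : v ∈ B
    · exact hB v hvB
    · obtain ⟨e, w, hj, hw⟩ := hearlier v hvB
      obtain ⟨b, hb, hb'⟩ : ∃ b, G.endVertex (e, b) = v ∧ G.endVertex (e, !b) = w := by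
        rcases hj with ⟨h1, h2⟩ | ⟨h1, h2⟩
        · exact ⟨false, h1, h2⟩
        · exact ⟨true, h2, h1⟩
      have hz := ih (τ w) (hv ▸ hw) w rfl (e, !b) hb'
      rw [← hb, ← hval (e, b)]
      exact hz (G.endCoord_mem (e, b))
  -- all edges at `v` except possibly one in `O` that leads to a later vertex
  have hmost : ∀ p, G.endVertex p = v → ¬ (p.1 ∈ O ∧ G.earlyEnd τ p.1 = p) →
      EqOn (u p.1) 0 (G.edge p.1) := by
    intro p hp hpO
    rcases lt_trichotomy (τ (G.endVertex (p.1, !p.2))) (τ (G.endVertex p)) with hlt | heq | hgt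
    · exact ih _ (by rw [← hv, ← hp]; exact hlt) _ rfl (p.1, !p.2) rfl
    · have hloop := hτ heq
      have hends : ∀ b, G.endVertex (p.1, b) = v := by
        intro b
        by_cases hb : b = p.2
        · rw [hb]; exact hp
        · have : b = !p.2 := by rcases p with ⟨e, _ | _⟩ <;> cases b <;> simp_all
          rw [this, hloop, hp]
      have hnO : p.1 ∉ O := fun h => hO _ h ((hends false).trans (hends true).symm)
      have h1 := hval (G.earlyEnd τ p.1)
      rw [earlyEnd, hends, hv0] at h1
      exact G.eqOn_zero_of_endpoint hq hu.1 hu.2.1 (G.earlyEnd τ p.1) h1 (hd _ hnO)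
    · have he := G.earlyEnd_eq hgt
      have hnO : p.1 ∉ O := fun h => hpO ⟨h, he⟩
      refine G.eqOn_zero_of_endpoint hq hu.1 hu.2.1 p (by rw [hval, hp, hv0]) ?_
      rw [← he]; exact hd _ hnO
  intro p hp
  by_cases hpO : p.1 ∈ O ∧ G.earlyEnd τ p.1 = p
  · refine G.eqOn_zero_of_endpoint hq hu.1 hu.2.1 p (by rw [hval, hp, hv0]) ?_
    have hN : G.normalDeriv u v = 0 := by
      have := hu.2.2.2 v
      rwa [deltaDefect, hv0, mul_zero, sub_zero] at this
    rw [normalDeriv_eq_sum, Finset.sum_eq_single p, if_pos hp] at hN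
    · refine (mul_eq_zero.1 hN).resolve_left ?_
      rcases p with ⟨e, _ | _⟩ <;> simp
    · intro p' _ hne
      split_ifs with hp'
      · rw [G.endDeriv_eq_zero p' (hmost p' hp' fun hO2 => hne ?_), mul_zero]
        have h1 : p'.1 = p.1 := hO' _ hO2.1 _ hpO.1 (by rw [hO2.2, hpO.2, hp, hp'])
        rw [← hO2.2, ← hpO.2, h1]
      · rfl
    · simp
  · exact hmost p hp hpO

variable [Fintype E]

/-- The number of edges not in `O` bounds the dimension of the space of eigenfunctions that vanish
on `B`. -/
theorem finrank_ker_restrictionMap_le (hq : ∀ e, IntegrableOn (q e) (Icc 0 (G.length e)))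
    (α : V → ℝ) (B : Finset V) (μ : ℂ) (τ : V → ℕ) (hτ : Function.Injective τ)
    (hearlier : ∀ v, v ∉ B → ∃ e w, G.Joins e v w ∧ τ w < τ v) (O : Finset E)
    (hO : ∀ e ∈ O, G.init e ≠ G.term e)
    (hO' : ∀ e ∈ O, ∀ e' ∈ O, G.endVertex (G.earlyEnd τ e) = G.endVertex (G.earlyEnd τ e') →
      e = e') :
    Module.finrank ℂ (LinearMap.ker (G.restrictionMap hq α B μ)) + O.card ≤ Fintype.card E := by
  classical
  have hadd : ∀ (x y : E × Bool → ℂ) (p : E × Bool), G.endDeriv (G.solutionFun hq μ (x + y)) p =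
      G.endDeriv (G.solutionFun hq μ x) p + G.endDeriv (G.solutionFun hq μ y) p := by
    intro x y p
    rw [solutionFun_add]
    exact (G.isAC2_solutionFun hq μ x).D_add_eqOn (G.isAC2_solutionFun hq μ y) p.1
      (G.endCoord_mem p)
  have hsmul : ∀ (c : ℂ) (x : E × Bool → ℂ) (p : E × Bool),
      G.endDeriv (G.solutionFun hq μ (c • x)) p = c * G.endDeriv (G.solutionFun hq μ x) p := by
    intro c x p
    rw [solutionFun_smul]
    simp only [endDeriv, Pi.smul_apply, D_smul, smul_eq_mul]
  -- the derivatives at the early ends of the edges not in `O`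
  let Λ : (E × Bool → ℂ) →ₗ[ℂ] ((Oᶜ : Finset E) → ℂ) :=
    { toFun := fun x e => G.endDeriv (G.solutionFun hq μ x) (G.earlyEnd τ e)
      map_add' := fun x y => funext fun e => hadd _ _ _
      map_smul' := fun c x => funext fun e => hsmul _ _ _ }
  let K := (LinearMap.ker (G.restrictionMap hq α B μ)).map (Submodule.subtype _)
  have hK : Module.finrank ℂ K = Module.finrank ℂ (LinearMap.ker (G.restrictionMap hq α B μ)) :=
    Submodule.finrank_map_subtype_eq _ _
  have hinj : Function.Injective (Λ.domRestrict K) := by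
    refine (injective_iff_map_eq_zero _).2 fun x hx => ?_
    obtain ⟨_, ⟨⟨y, hy⟩, hyB, rfl⟩⟩ := x
    have hs := (G.mem_ker_characteristicMap_iff hq α μ _).1 hy
    refine Subtype.ext (G.eq_zero_of_solutionFun_eqOn_zero hq
      (IsSolution.eqOn_zero_of_endDeriv G hq hs (fun b hb => ?_) τ hτ hearlier O hO hO'
        fun e he => ?_))
    · exact congrFun (LinearMap.mem_ker.1 hyB) ⟨b, hb⟩
    · exact congrFun hx ⟨e, Finset.mem_compl.2 he⟩
  have h := LinearMap.finrank_le_finrank_of_injective hinj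
  rw [hK, Module.finrank_fintype_fun_eq_card, Fintype.card_coe] at h
  have h2 := Finset.card_compl_add_card O
  omega

end Propagation

/-! ### Spanning trees and orders of the vertices -/

variable {V E : Type*} (G : MetricGraph V E)

/-- A spanning tree with root `r` and edges in the set `S`: each vertex `v` other than `r` is
joined to its parent by the edge `edgeTo v`, and the depth decreases from a vertex to its parent.
The values at `r` are irrelevant. -/
structure SpanningTree (S : Set E) (r : V) where
  parent : V → V
  edgeTo : V → E
  depth : V → ℕ
  edgeTo_mem : ∀ v, v ≠ r → edgeTo v ∈ S
  joins : ∀ v, v ≠ r → G.Joins (edgeTo v) v (parent v)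
  depth_lt : ∀ v, v ≠ r → depth (parent v) < depth v

/-- Breadth-first search. -/
theorem nonempty_spanningTree {S : Set E}
    (hS : ∀ v w, Relation.EqvGen (fun a b => ∃ e ∈ S, G.Joins e a b) v w) (r : V) :
    Nonempty (G.SpanningTree S r) := by
  let H : SimpleGraph V :=
    { Adj := fun a b => a ≠ b ∧ ∃ e ∈ S, G.Joins e a b
      symm := ⟨fun a b h => ⟨h.1.symm, h.2.imp fun e he => ⟨he.1, he.2.symm⟩⟩⟩
      loopless := ⟨fun a h => h.1 rfl⟩ }
  have hH : ∀ v w, H.Reachable v w := by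
    intro v w
    induction hS v w with
    | rel a b h =>
      by_cases hab : a = b
      · rw [hab]
      · exact SimpleGraph.Adj.reachable (show H.Adj a b from ⟨hab, h⟩)
    | refl a => exact SimpleGraph.Reachable.refl a
    | symm a b _ h => exact h.symm
    | trans a b c _ _ h1 h2 => exact h1.trans h2
  have key : ∀ v, ∃ (w : V) (e : E),
      v ≠ r → e ∈ S ∧ G.Joins e v w ∧ H.dist w r < H.dist v r := by
    intro v
    by_cases hv : v = r
    · exact ⟨v, (G.exists_edge v).choose, fun h => absurd hv h⟩
    obtain ⟨p, hp⟩ := (hH v r).exists_walk_length_eq_dist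
    obtain ⟨w, hvw, p', rfl⟩ := SimpleGraph.Walk.exists_eq_cons_of_ne hv p
    obtain ⟨e, he, hj⟩ := hvw.2
    refine ⟨w, e, fun _ => ⟨he, hj, ?_⟩⟩
    have := SimpleGraph.dist_le p'
    rw [SimpleGraph.Walk.length_cons] at hp
    omega
  choose P e h using key
  exact ⟨⟨P, e, fun v => H.dist v r, fun v hv => (h v hv).1, fun v hv => (h v hv).2.1,
    fun v hv => (h v hv).2.2⟩⟩

variable {G}

theorem IsConnected.nonempty_spanningTree (hG : G.IsConnected) (r : V) :
    Nonempty (G.SpanningTree univ r) :=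
  G.nonempty_spanningTree
    (fun v w => (hG v w).mono fun _ _ ⟨e, he⟩ => ⟨e, mem_univ e, Or.inl he⟩) r

namespace SpanningTree

variable {S : Set E} {r : V} (T : G.SpanningTree S r)

/-- The edges that do not belong to the tree. -/
def chords : Set E := {e | ∀ u, u ≠ r → T.edgeTo u ≠ e}

theorem edgeTo_injOn : InjOn T.edgeTo {v | v ≠ r} := by
  intro u hu v hv huv
  have h1 := T.joins u hu
  rw [huv] at h1
  rcases h1.eq_or_eq (T.joins v hv) with ⟨h, -⟩ | ⟨h, h'⟩
  · exact h
  · have h2 := T.depth_lt u hu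
    have h3 := T.depth_lt v hv
    rw [← h] at h3
    rw [h'] at h2
    omega

theorem ncard_chords [Fintype V] [Fintype E] : (T.chords.ncard : ℤ) = G.cyc := by
  classical
  have h1 : T.chords = (T.edgeTo '' {v | v ≠ r})ᶜ := by
    ext e
    simp [chords]
  have h2 := Set.ncard_add_ncard_compl (T.edgeTo '' {v | v ≠ r})
  have h3 : ({v | v ≠ r} : Set V).ncard + 1 = Fintype.card V := by
    have := Set.ncard_add_ncard_compl ({r} : Set V)
    rw [Set.ncard_singleton, Nat.card_eq_fintype_card] at this
    rw [add_comm]; exact this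
  rw [T.edgeTo_injOn.ncard_image, ← h1, Nat.card_eq_fintype_card] at h2
  rw [cyc]
  omega

/-- The tree edges alone connect any two vertices. -/
theorem eqvGen (v w : V) :
    Relation.EqvGen (fun a b => ∃ e ∈ T.chordsᶜ, G.Joins e a b) v w := by
  have key : ∀ n v, T.depth v = n →
      Relation.EqvGen (fun a b => ∃ e ∈ T.chordsᶜ, G.Joins e a b) v r := by
    intro n
    induction n using Nat.strong_induction_on with
    | _ n ih =>
    intro v hv
    by_cases h : v = r
    · rw [h]; exact .refl r
    · refine .trans _ _ _ (.rel _ _ ⟨T.edgeTo v, fun hc => hc v h rfl, T.joins v h⟩)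
        (ih _ (hv ▸ T.depth_lt v h) _ rfl)
  exact .trans _ _ _ (key _ v rfl) (.symm _ _ (key _ w rfl))

/-- A vertex that is not the root and not a parent either has degree one or is attached to an edge
that does not belong to the tree. -/
theorem degree_eq_one_or_exists_chord {v : V} (hv : v ≠ r) (hleaf : ∀ u, u ≠ r → T.parent u ≠ v) :
    G.degree v = 1 ∨ ∃ e ∈ T.chords, ∃ w, G.Joins e v w := by
  obtain ⟨b, hb, hb'⟩ : ∃ b, G.endVertex (T.edgeTo v, b) = v ∧
      G.endVertex (T.edgeTo v, !b) = T.parent v := by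
    rcases T.joins v hv with ⟨h1, h2⟩ | ⟨h1, h2⟩
    · exact ⟨false, h1, h2⟩
    · exact ⟨true, h2, h1⟩
  by_cases h : ∀ p, G.endVertex p = v → p = (T.edgeTo v, b)
  · left
    rw [degree, Set.ncard_eq_one]
    refine ⟨(T.edgeTo v, b), Set.ext fun p => ⟨h p, ?_⟩⟩
    rintro rfl
    exact hb
  · right
    push Not at h
    obtain ⟨p, hp, hne⟩ := h
    have hj := joins_endVertex (G := G) p
    rw [hp] at hj
    refine ⟨p.1, fun u hu hup => ?_, _, hj⟩
    have hju := T.joins u hu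
    rw [hup] at hju
    rcases hj.eq_or_eq hju with ⟨h1, -⟩ | ⟨h1, -⟩
    · subst h1
      have h2 : p = (T.edgeTo v, !b) :=
        Prod.ext hup.symm (Bool.eq_not.2 fun h3 => hne (Prod.ext hup.symm h3))
      rw [h2, hb'] at hp
      have := T.depth_lt v hv
      rw [hp] at this
      exact lt_irrefl _ this
    · exact hleaf u hu h1.symm

end SpanningTree

/-- Ties of `t` are broken by an enumeration of `V`. -/
theorem exists_injective_refinement [Finite V] (t : V → ℕ) :
    ∃ τ : V → ℕ, Function.Injective τ ∧ ∀ v w, t v < t w → τ v < τ w := by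
  obtain ⟨N, ⟨f⟩⟩ := Finite.exists_equiv_fin V
  refine ⟨fun v => t v * N + f v, fun v w h => ?_, fun v w h => ?_⟩
  · have h' := congrArg (· % N) h
    simp only [Nat.mul_add_mod_self_right, Nat.mod_eq_of_lt (f _).2] at h'
    exact f.injective (Fin.ext h')
  · have h1 : (t v + 1) * N ≤ t w * N := Nat.mul_le_mul_right N h
    have h2 := (f v).2
    have h3 : (t v + 1) * N = t v * N + N := by ring
    show t v * N + f v < t w * N + f w
    omega

variable (G) in
/-- No edge leads from `v` to a vertex that is later than `v` in the order given by `τ`. -/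
def IsSink (τ : V → ℕ) (v : V) : Prop := ∀ e w, G.Joins e v w → τ w ≤ τ v

/-- The order is such that one walks from the vertices of `B` towards the root first, and from
there away from the root into the branches that have not been visited. -/
theorem SpanningTree.exists_order [Finite V] {S : Set E} {r : V} (T : G.SpanningTree S r)
    {B : Set V} (hB : B.Nonempty) :
    ∃ τ : V → ℕ, Function.Injective τ ∧ (∀ v, v ∉ B → ∃ e w, G.Joins e v w ∧ τ w < τ v) ∧
      ∀ v, v ≠ r → G.IsSink τ v → v ∉ B ∧ ∀ u, u ≠ r → T.parent u ≠ v := by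
  classical
  -- the set of the ancestors of elements of `B`
  let A : Set V := {v | ∃ b ∈ B, Relation.ReflTransGen (fun v w => v ≠ r ∧ T.parent v = w) b v}
  have hAB : ∀ v ∈ B, v ∈ A := fun v hv => ⟨v, hv, .refl⟩
  have hAp : ∀ v ∈ A, v ≠ r → T.parent v ∈ A := fun v ⟨b, hb, h⟩ hv => ⟨b, hb, h.tail ⟨hv, rfl⟩⟩
  have hAc : ∀ v ∈ A, v ∉ B → ∃ u ∈ A, u ≠ r ∧ T.parent u = v := by
    rintro v ⟨b, hb, h⟩ hv
    rcases h.cases_tail with rfl | ⟨c, hc, h1, h2⟩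
    · exact absurd hb hv
    · exact ⟨c, ⟨b, hb, hc⟩, h1, h2⟩
  have hr : r ∈ A := by
    have key : ∀ n, ∀ v ∈ A, T.depth v = n → r ∈ A := by
      intro n
      induction n using Nat.strong_induction_on with
      | _ n ih =>
      intro v hv hn
      by_cases h : v = r
      · exact h ▸ hv
      · exact ih _ (hn ▸ T.depth_lt v h) _ (hAp v hv h) rfl
    obtain ⟨b, hb⟩ := hB
    exact key _ b (hAB b hb) rfl
  obtain ⟨D, hD⟩ : ∃ D, ∀ v, T.depth v ≤ D := by
    obtain ⟨D, hD⟩ := (Set.finite_range T.depth).bddAbove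
    exact ⟨D, fun v => hD (mem_range_self v)⟩
  -- `A` comes first, by decreasing depth, then the other vertices, by increasing depth
  obtain ⟨τ, hτ, hlt⟩ := exists_injective_refinement
    fun v => if v ∈ A then D - T.depth v else D + 1 + T.depth v
  have hup : ∀ v ∈ A, v ≠ r → τ v < τ (T.parent v) := by
    intro v hv hvr
    apply hlt
    rw [if_pos hv, if_pos (hAp v hv hvr)]
    have := T.depth_lt v hvr
    have := hD v
    omega
  have hdown : ∀ v, v ∉ A → v ≠ r → τ (T.parent v) < τ v := by
    intro v hv hvr
    apply hlt
    have := T.depth_lt v hvr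
    rw [if_neg hv]
    split_ifs <;> omega
  refine ⟨τ, hτ, fun v hv => ?_, fun v hvr hs => ?_⟩
  · by_cases hvA : v ∈ A
    · obtain ⟨u, hu, hur, rfl⟩ := hAc v hvA hv
      exact ⟨_, u, (T.joins u hur).symm, hup u hu hur⟩
    · have hvr : v ≠ r := fun h => hvA (h ▸ hr)
      exact ⟨_, _, T.joins v hvr, hdown v hvA hvr⟩
  · have hvA : v ∉ A := fun hvA => (hup v hvA hvr).not_ge (hs _ _ (T.joins v hvr))
    refine ⟨fun h => hvA (hAB v h), ?_⟩
    rintro u hur rfl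
    have huA : u ∉ A := fun huA => hvA (hAp u huA hur)
    exact (hdown u huA hur).not_ge (hs _ _ (T.joins u hur).symm)

/-- The set `O` consists of one edge to a later vertex for each vertex that is not a sink. -/
theorem exists_outgoing_edges [Fintype V] (τ : V → ℕ) :
    ∃ O : Finset E, (∀ e ∈ O, G.init e ≠ G.term e) ∧
      (∀ e ∈ O, ∀ e' ∈ O, G.endVertex (G.earlyEnd τ e) = G.endVertex (G.earlyEnd τ e') → e = e') ∧
      Fintype.card V = O.card + {v | G.IsSink τ v}.ncard := by
  classical
  have key : ∀ v, ∃ (e : E) (w : V), ¬ G.IsSink τ v → G.Joins e v w ∧ τ v < τ w := by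
    intro v
    by_cases h : G.IsSink τ v
    · exact ⟨(G.exists_edge v).choose, v, fun h' => absurd h h'⟩
    · simp only [IsSink] at h
      push Not at h
      obtain ⟨e, w, h1, h2⟩ := h
      exact ⟨e, w, fun _ => ⟨h1, h2⟩⟩
  choose f w hf using key
  have hearly : ∀ v, ¬ G.IsSink τ v → G.endVertex (G.earlyEnd τ (f v)) = v := by
    intro v hv
    obtain ⟨hj, hlt⟩ := hf v hv
    rcases hj with ⟨h1, h2⟩ | ⟨h1, h2⟩
    · have h3 : τ (G.endVertex (f v, false)) < τ (G.endVertex (f v, true)) := by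
        simpa [endVertex, h1, h2] using hlt
      rw [show G.earlyEnd τ (f v) = (f v, false) from G.earlyEnd_eq h3]
      exact h1
    · have h3 : τ (G.endVertex (f v, true)) < τ (G.endVertex (f v, false)) := by
        simpa [endVertex, h1, h2] using hlt
      rw [show G.earlyEnd τ (f v) = (f v, true) from G.earlyEnd_eq h3]
      exact h2
  refine ⟨(Finset.univ.filter fun v => ¬ G.IsSink τ v).image f, ?_, ?_, ?_⟩
  · intro e he
    obtain ⟨v, hv, rfl⟩ := Finset.mem_image.1 he
    obtain ⟨hj, hlt⟩ := hf v (Finset.mem_filter.1 hv).2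
    intro h
    refine hlt.ne (congrArg τ ?_)
    rcases hj with ⟨h1, h2⟩ | ⟨h1, h2⟩
    · exact h1.symm.trans (h.trans h2)
    · exact h2.symm.trans (h.symm.trans h1)
  · intro e he e' he' h
    obtain ⟨v, hv, rfl⟩ := Finset.mem_image.1 he
    obtain ⟨v', hv', rfl⟩ := Finset.mem_image.1 he'
    rw [hearly v (Finset.mem_filter.1 hv).2, hearly v' (Finset.mem_filter.1 hv').2] at h
    rw [h]
  · rw [Finset.card_image_of_injOn]
    · have h1 := Finset.card_filter_add_card_filter_not (s := (Finset.univ : Finset V))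
        (fun v => G.IsSink τ v)
      have h2 : {v | G.IsSink τ v} =
          ((Finset.univ.filter fun v => G.IsSink τ v : Finset V) : Set V) := by
        ext v; simp
      rw [h2, Set.ncard_coe_finset, ← Finset.card_univ]
      omega
    · intro v hv v' hv' h
      rw [← hearly v (by simpa using hv), ← hearly v' (by simpa using hv'), h]

/-- Two distinct sinks are not attached to a common edge. -/
theorem IsSink.eq_of_joins {τ : V → ℕ} (hτ : Function.Injective τ) {e : E} {v v' w w' : V}
    (hv : G.IsSink τ v) (hv' : G.IsSink τ v') (hj : G.Joins e v w) (hj' : G.Joins e v' w') :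
    v = v' := by
  rcases hj.eq_or_eq hj' with ⟨h, -⟩ | ⟨h1, h2⟩
  · exact h
  · subst h1 h2
    exact hτ (le_antisymm (hv' _ _ hj') (hv _ _ hj))

theorem ncard_isSink_le [Finite V] [Finite E] {τ : V → ℕ} (hτ : Function.Injective τ)
    (F : Set V) (C : Set E) (h : ∀ v, G.IsSink τ v → v ∉ F → ∃ e ∈ C, ∃ w, G.Joins e v w) :
    {v | G.IsSink τ v}.ncard ≤ F.ncard + C.ncard := by
  have key : ∀ v, ∃ e : E, G.IsSink τ v → v ∉ F → e ∈ C ∧ ∃ w, G.Joins e v w := by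
    intro v
    by_cases hv : G.IsSink τ v ∧ v ∉ F
    · obtain ⟨e, he⟩ := h v hv.1 hv.2
      exact ⟨e, fun _ _ => he⟩
    · exact ⟨(G.exists_edge v).choose, fun h1 h2 => absurd ⟨h1, h2⟩ hv⟩
  choose f hf using key
  have h1 : ({v | G.IsSink τ v} \ F).ncard ≤ C.ncard := by
    refine Set.ncard_le_ncard_of_injOn f (fun v hv => (hf v hv.1 hv.2).1) ?_ (Set.toFinite C)
    intro v hv v' hv' hff
    obtain ⟨-, w, hw⟩ := hf v hv.1 hv.2
    obtain ⟨-, w', hw'⟩ := hf v' hv'.1 hv'.2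
    rw [← hff] at hw'
    exact hv.1.eq_of_joins hτ hv'.1 hw hw'
  have h2 := Set.ncard_le_ncard_sdiff_add_ncard {v | G.IsSink τ v} F (Set.toFinite F)
  omega

/-! ### The dimension of the space of eigenfunctions that vanish on `B` -/

section Bound

variable [Fintype V] [Fintype E] {q : E → ℝ → ℝ} {S : Set E} {r : V}

/-- If the root of the tree lies in `∂G ∖ B` or on an edge outside the tree, then each sink is
either an element of `∂G ∖ B` or attached to an edge outside the tree. -/
theorem SpanningTree.finrank_ker_restrictionMap_le (T : G.SpanningTree S r)
    (hq : ∀ e, IntegrableOn (q e) (Icc 0 (G.length e))) (α : V → ℝ) {B : Finset V}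
    (hB : B ⊆ G.boundary) (hB' : B.Nonempty) (μ : ℂ)
    (hr : r ∈ G.boundary ∧ r ∉ B ∨ ∃ e ∈ T.chords, ∃ w, G.Joins e r w) :
    (Module.finrank ℂ (LinearMap.ker (G.restrictionMap hq α B μ)) : ℤ) ≤
      2 * G.cyc + G.boundary.card - B.card - 1 := by
  classical
  obtain ⟨τ, hτ, hearlier, hsink⟩ := T.exists_order (B := (B : Set V)) hB'
  obtain ⟨O, hO, hO', hcard⟩ := exists_outgoing_edges (G := G) τ
  have h1 := G.finrank_ker_restrictionMap_le hq α B μ τ hτ hearlier O hO hO'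
  have h2 := ncard_isSink_le (G := G) hτ ((G.boundary \ B : Finset V) : Set V) T.chords
    fun v hv hvF => by
      by_cases hvr : v = r
      · subst hvr
        exact hr.resolve_left fun h => hvF (by simpa using h)
      · obtain ⟨h3, h4⟩ := hsink v hvr hv
        refine (T.degree_eq_one_or_exists_chord hvr h4).resolve_left fun h5 => hvF ?_
        rw [Finset.mem_coe, Finset.mem_sdiff]
        exact ⟨by simp [boundary, h5], h3⟩
  have h3 := T.ncard_chords
  rw [Set.ncard_coe_finset, Finset.card_sdiff_of_subset hB] at h2
  have h4 := Finset.card_le_card hB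
  have h5 : G.cyc = 1 + Fintype.card E - Fintype.card V := rfl
  omega

theorem finrank_ker_restrictionMap_le_of_not_tree (hG : G.IsConnected)
    (hq : ∀ e, IntegrableOn (q e) (Icc 0 (G.length e))) (α : V → ℝ) {B : Finset V}
    (hB : B ⊆ G.boundary) (hB' : B.Nonempty) (μ : ℂ) (h : ¬ (G.cyc = 0 ∧ B = G.boundary)) :
    (Module.finrank ℂ (LinearMap.ker (G.restrictionMap hq α B μ)) : ℤ) ≤
      2 * G.cyc + G.boundary.card - B.card - 1 := by
  classical
  by_cases hF : B = G.boundary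
  · -- The root is an endpoint of an edge `e` that is not a bridge, and the tree avoids `e`.
    obtain ⟨T₀⟩ := hG.nonempty_spanningTree hB'.choose
    have hne : T₀.chords.Nonempty := by
      rw [Set.nonempty_iff_ne_empty]
      intro h0
      have := T₀.ncard_chords
      rw [h0, Set.ncard_empty] at this
      exact h ⟨this.symm, hF⟩
    obtain ⟨e, he⟩ := hne
    obtain ⟨T⟩ := G.nonempty_spanningTree T₀.eqvGen (G.init e)
    exact T.finrank_ker_restrictionMap_le hq α hB hB' μ
      (Or.inr ⟨e, fun u hu hue => T.edgeTo_mem u hu (by rw [hue]; exact he), _, Or.inl ⟨rfl, rfl⟩⟩)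
  · obtain ⟨r, hr⟩ : (G.boundary \ B).Nonempty := by
      rw [Finset.sdiff_nonempty]
      exact fun h' => hF (hB.antisymm h')
    obtain ⟨T⟩ := hG.nonempty_spanningTree r
    exact T.finrank_ker_restrictionMap_le hq α hB hB' μ (Or.inl (Finset.mem_sdiff.1 hr))

/-- On a tree, only the root is a sink. -/
theorem finrank_ker_restrictionMap_of_tree (hG : G.IsConnected)
    (hq : ∀ e, IntegrableOn (q e) (Icc 0 (G.length e))) (α : V → ℝ)
    (hB : G.boundary.Nonempty) (μ : ℂ) (h : G.cyc = 0) :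
    Module.finrank ℂ (LinearMap.ker (G.restrictionMap hq α G.boundary μ)) = 0 := by
  classical
  obtain ⟨r, -⟩ := id hB
  obtain ⟨T⟩ := hG.nonempty_spanningTree r
  obtain ⟨τ, hτ, hearlier, hsink⟩ := T.exists_order (B := (G.boundary : Set V)) hB
  obtain ⟨O, hO, hO', hcard⟩ := exists_outgoing_edges (G := G) τ
  have h1 := G.finrank_ker_restrictionMap_le hq α G.boundary μ τ hτ hearlier O hO hO'
  have h3 := T.ncard_chords
  have hC : T.chords = ∅ := by
    rw [← Set.ncard_eq_zero]
    omega
  have h2 : {v | G.IsSink τ v}.ncard ≤ ({r} : Set V).ncard := by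
    refine Set.ncard_le_ncard (fun v hv => ?_) (Set.toFinite _)
    by_contra hvr
    obtain ⟨h4, h5⟩ := hsink v hvr hv
    rcases T.degree_eq_one_or_exists_chord hvr h5 with h6 | ⟨e, he, -⟩
    · exact h4 (by simp [boundary, h6])
    · rw [hC] at he
      exact he
  rw [Set.ncard_singleton] at h2
  have h5 : G.cyc = 1 + Fintype.card E - Fintype.card V := rfl
  omega

end Bound

end MetricGraph

end

theorem mainTheorem1 {V E : Type*} [Fintype V] [Fintype E] (G : MetricGraph V E)
    (hG : G.IsConnected) (q : E → ℝ → ℝ)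
    (hq : ∀ e, IntegrableOn (q e) (Icc 0 (G.length e)) volume) (α : V → ℝ)
    (B : Finset V) (hB : B ⊆ G.boundary) (hB' : B.Nonempty) (lam : ℝ) :
    let A := G.schrodingerOperator q α
    let M := G.titchmarshWeyl q α B
    let bound : ℤ := 2 * G.cyc + G.boundary.card - B.card - 1
    FiniteDimensional ℂ (A.eigenspace lam) ∧
    (MatrixFunction.IsPole A.resolventSet M lam → A.IsEigenvalue lam) ∧
    (A.IsEigenvalue lam → bound < Module.finrank ℂ (A.eigenspace lam) →
      MatrixFunction.IsPole A.resolventSet M lam) ∧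
    ∃ R : Matrix B B ℂ, MatrixFunction.HasResidue A.resolventSet M lam R ∧
      (G.cyc = 0 ∧ B = G.boundary → Module.finrank ℂ (A.eigenspace lam) = R.rank) ∧
      (¬ (G.cyc = 0 ∧ B = G.boundary) →
        R.rank ≤ Module.finrank ℂ (A.eigenspace lam) ∧
        (Module.finrank ℂ (A.eigenspace lam) : ℤ) ≤ R.rank + bound) := by
  classical
  intro A M bound
  -- the eigenspace, in terms of Cauchy data, and its restriction map to `B`
  let K := LinearMap.ker (G.characteristicMap hq α lam)
  let T : K →ₗ[ℂ] (B → ℂ) := G.restrictionMap hq α B lam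
  let φ : K ≃ₗ[ℂ] A.eigenspace lam := G.eigenspaceEquiv hq α lam
  have hfin : FiniteDimensional ℂ (A.eigenspace lam) := φ.finiteDimensional
  obtain ⟨R, hR, hpole, hrank⟩ := G.exists_residue hq α B lam
  have hdim : R.rank + Module.finrank ℂ (LinearMap.ker T) =
      Module.finrank ℂ (A.eigenspace lam) := by
    rw [hrank, ← φ.finrank_eq]
    exact T.finrank_range_add_finrank_ker
  have htree : G.cyc = 0 ∧ B = G.boundary → Module.finrank ℂ (LinearMap.ker T) = 0 := by
    rintro ⟨h, rfl⟩
    exact MetricGraph.finrank_ker_restrictionMap_of_tree hG hq α hB' lam h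
  have hother : ¬ (G.cyc = 0 ∧ B = G.boundary) →
      (Module.finrank ℂ (LinearMap.ker T) : ℤ) ≤ bound :=
    MetricGraph.finrank_ker_restrictionMap_le_of_not_tree hG hq α hB hB' lam
  have heig : A.IsEigenvalue lam ↔ 0 < Module.finrank ℂ (A.eigenspace lam) := by
    rw [Module.finrank_pos_iff, Submodule.nontrivial_iff_ne_bot]
    rfl
  have hrank0 : R ≠ 0 ↔ 0 < R.rank := by
    rw [Matrix.rank, Module.finrank_pos_iff, Submodule.nontrivial_iff_ne_bot, Ne, Ne,
      LinearMap.range_eq_bot, ← Matrix.toLin'_apply', LinearEquiv.map_eq_zero_iff]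
  refine ⟨hfin, fun h => ?_, fun h h' => ?_, R, hR, fun h => ?_, fun h => ?_⟩
  · have := hrank0.1 (hpole.1 h)
    rw [heig]
    omega
  · rw [heig] at h
    refine hpole.2 (hrank0.2 ?_)
    by_cases ht : G.cyc = 0 ∧ B = G.boundary
    · have := htree ht
      omega
    · have := hother ht
      omega
  · have := htree h
    omega
  · have := hother h
    omega
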